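/- **Theorem 5.2.** For $M\in\mathbb R^{n\times d}$, $b\in\mathbb R^n$ and $\sigma\in\mathbb N$ consider the semidefinite program (SILS-SDP) $$\min\ \tfrac1n\operatorname{tr}(A^\top A W)\quad\text{s.t. } W\succeq 0,\ W_{11}=1,\ \operatorname{tr}(W_x)=\sigma,\ 1_d^\top|W_x|1_d\le\sigma^2,\ \operatorname{diag}(W_x)\le 1_d,$$ where $A=(-b\ \ M)$, $W$ ranges over the real $(1+d)\times(1+d)$ matrices and $W_x$ is $W$ without its first row and column. It *recovers* $x^*$ if $x^*\in\{0,\pm1\}^d$ and $\binom{1}{x^*}\binom{1}{x^*}^\top$ is its unique optimal solution. A real random variable $X$ with mean $0$ is $\mathcal{SG}(L^2)$ if $\mathbb E e^{tX}\le e^{t^2L^2/2}$ for all $t\in\mathbb R$; a centered random vector $X$ is $\mathcal{SG}(L^2)$ if $X^\top v$ is $\mathcal{SG}(L^2)$ for every unit vector $v$. Below, $\|\cdot\|$ is the Euclidean norm, $\|\cdot\|_\infty$ is the largest absolute value of an entry of a vector or matrix ($0$ if there are no entries), and $\lambda_{\min}$ is the smallest eigenvalue. There are absolute constants $c_1,B,B_1,B_2,K>0$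 such that for every $\kappa>0$ there is a constant $C>0$, depending only on $\kappa$, for which the following holds for all $n,d,\sigma$. Let $x^*\in\{0,\pm1\}^d$, $S:=\operatorname{supp}(x^*)$, $|S|=\sigma$, $z^*\in\mathbb R^d$, $L>0$, $\varrho\ge 0$, and let $b=Mz^*+\epsilon$, where the rows of $M$ are i.i.d. centered $\mathcal{SG}(L^2)$ random vectors in $\mathbb R^d$ with covariance matrix $\Sigma$, and $\epsilon$ is independent of $M$ and has i.i.d. centered $\mathcal{SG}(\varrho^2)$ entries. Put $\hat y^*:=-\Sigma z^*$ and $\hat Y^*_{11}:=-(\hat y^*_S)^\top x^*_S$, and assume $\hat Y_{11}^*>0$ and $\frac1\sigma\hat Y_{11}^*\ge\kappa$. For $v\in\mathbb R^S$ let $$f_n(v):=\sqrt{\frac{\|v\|^2}{(v^\top x_S^*)^2}-\frac1\sigma},\qquad \lambda_n:=B_2L\sqrt{\frac{(\varrho^2+L^2\|z^*\|^2)\log d}{n}} .$$ Suppose that there are $\delta>0$ and $\ell_n\in\mathbb R$ such that, with $$\hat\mu_3^*:=\frac1\sigma\Big\{\lambda_{\min}(\Sigma_{S,S})-\delta+\min_{i\in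 S}\frac{(-\hat y_S^*-\Sigma_{S,S}x_S^*)_i}{x_i^*}-\lambda_n-B_1L^2\sqrt{\frac{\sigma\log d}{n}}-c_1L^2\sqrt{\frac{\sigma}{n}}\Big\},$$ $$\gamma_n:=\frac1\delta\big(f_n(\hat y_S^*)+\ell_n\lambda_n\big)^2\big(\|\hat y^*_{S^c}\|_\infty+\lambda_n\big)^2,$$ the following conditions hold. * **D1.** $f_n$ is $\frac{\ell_n}{\sqrt\sigma}$-Lipschitz continuous at the point $\hat y_S^*$, that is, $|f_n(v)-f_n(\hat y_S^*)|\le\frac{\ell_n}{\sqrt\sigma}\|v-\hat y_S^*\|$ for all $v$ in some neighbourhood of $\hat y^*_S$. * **D2.** $\big\|\Sigma_{S,S^c}+\frac1\sigma x_S^*(\hat y^*_{S^c})^\top\big\|_\infty+BL^2\sqrt{\frac{\log d}{n}}+\frac1\sigma\lambda_n\le\hat\mu_3^*$. * **D3.** There is $\hat\mu_2^*\le-\lambda_{\min}(\Sigma_{S,S})-c_1L^2\sqrt{\frac\sigma n}+\delta$ such that $$\|\Sigma_{S^c,S^c}+\hat\mu_2^*I_{d-\sigma}\|_\infty+BL^2\sqrt{\frac{\log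 d}{n}}+\frac{(\|\hat y^*_{S^c}\|_\infty+\lambda_n)^2}{\hat Y_{11}^*-\sigma\lambda_n}+\gamma_n\le\hat\mu_3^* .$$ If $n\ge C\,L^2(\varrho^2+L^2\|z^*\|^2+\sigma)\log d$, then (SILS-SDP) with data $(M,b,\sigma)$ recovers $x^*$ with probability at least $1-K\big(\frac1d+e^{-\sigma}\big)$. -/

import Mathlib

open MeasureTheory ProbabilityTheory Matrix Filter Topology
open scoped NNReal

namespace SILS

noncomputable section

/-! ### Vectors and matrices -/

/-- The support of a vector. -/
def supp {d : ℕ} (x : Fin d → ℝ) : Finset (Fin d) := Finset.univ.filter fun i => x i ≠ 0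

/-- The subvector `v_T`. -/
def sub {d : ℕ} (T : Finset (Fin d)) (v : Fin d → ℝ) : T → ℝ := fun i => v i

/-- The submatrix `A_{T,U}`. -/
def block {d : ℕ} (T U : Finset (Fin d)) (A : Matrix (Fin d) (Fin d) ℝ) : Matrix T U ℝ :=
  A.submatrix (fun i => (i : Fin d)) (fun j => (j : Fin d))

/-- The Euclidean norm. -/
def l2norm {ι : Type*} [Fintype ι] (v : ι → ℝ) : ℝ := ‖WithLp.toLp 2 v‖

/-- The `∞`-norm of a vector (zero on an empty index set). -/
def infNorm {ι : Type*} (v : ι → ℝ) : ℝ := ⨆ i, |v i|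

/-- The largest absolute value of an entry of a matrix (zero if there are no entries). -/
def maxNorm {ι κ : Type*} (A : Matrix ι κ ℝ) : ℝ := ⨆ i, ⨆ j, |A i j|

/-- The smallest eigenvalue; it is used for real symmetric matrices of positive size only. -/
def lambdaMin {ι : Type*} [Fintype ι] [DecidableEq ι] (A : Matrix ι ι ℝ) : ℝ :=
  sInf (spectrum ℝ A)

/-! ### The semidefinite relaxation -/

/-- The `n × (1 + d)` matrix `A = (-b  M)`. -/
def augMatrix {n d : ℕ} (M : Matrix (Fin n) (Fin d) ℝ) (b : Fin n → ℝ) :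
    Matrix (Fin n) (Fin (d + 1)) ℝ :=
  Matrix.of fun i => Fin.cons (-b i) (M i)

/-- `W_x`: the matrix `W` without its first row and column. -/
def dropFirst {d : ℕ} (W : Matrix (Fin (d + 1)) (Fin (d + 1)) ℝ) : Matrix (Fin d) (Fin d) ℝ :=
  W.submatrix Fin.succ Fin.succ

/-- The feasible set of the semidefinite program. -/
structure IsFeasible {d : ℕ} (σ : ℕ) (W : Matrix (Fin (d + 1)) (Fin (d + 1)) ℝ) : Prop where
  posSemidef : W.PosSemidef
  corner : W 0 0 = 1
  trace_eq : (dropFirst W).trace = σ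
  abs_sum_le : ∑ i, ∑ j, |dropFirst W i j| ≤ (σ : ℝ) ^ 2
  diag_le : ∀ i, dropFirst W i i ≤ 1

/-- The cost `(1/n) tr(Aᵀ A W)`. -/
def cost {n d : ℕ} (M : Matrix (Fin n) (Fin d) ℝ) (b : Fin n → ℝ)
    (W : Matrix (Fin (d + 1)) (Fin (d + 1)) ℝ) : ℝ :=
  1 / (n : ℝ) * ((augMatrix M b)ᵀ * augMatrix M b * W).trace

/-- Optimal solutions of the semidefinite program. -/
def IsOptimal {n d : ℕ} (M : Matrix (Fin n) (Fin d) ℝ) (b : Fin n → ℝ) (σ : ℕ)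
    (W : Matrix (Fin (d + 1)) (Fin (d + 1)) ℝ) : Prop :=
  IsFeasible σ W ∧ ∀ W', IsFeasible σ W' → cost M b W ≤ cost M b W'

/-- The rank-one matrix `(1, x)ᵀ (1, x)`. -/
def lift {d : ℕ} (x : Fin d → ℝ) : Matrix (Fin (d + 1)) (Fin (d + 1)) ℝ :=
  Matrix.vecMulVec (Fin.cons 1 x) (Fin.cons 1 x)

/-- `x ∈ {0, ±1}^d`. -/
def IsTernary {d : ℕ} (x : Fin d → ℝ) : Prop := ∀ i, x i = 0 ∨ x i = 1 ∨ x i = -1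

/-- The semidefinite program with data `(M, b, σ)` recovers `x`: the vector `x` lies in
`{0, ±1}^d` and `lift x` is the one and only optimal solution. -/
def Recovers {n d : ℕ} (M : Matrix (Fin n) (Fin d) ℝ) (b : Fin n → ℝ) (σ : ℕ)
    (x : Fin d → ℝ) : Prop :=
  IsTernary x ∧ IsOptimal M b σ (lift x) ∧ ∀ W, IsOptimal M b σ W → W = lift x

/-! ### The random data -/

/-- The rows of `M` are i.i.d. centered sub-Gaussian random vectors with parameter `L` and
covariance matrix `Sig`. -/
structure IsSubGaussianDesign {Ω : Type*} [MeasurableSpace Ω] (P : Measure Ω) {n d : ℕ}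
    (M : Ω → Matrix (Fin n) (Fin d) ℝ) (L : ℝ≥0) (Sig : Matrix (Fin d) (Fin d) ℝ) : Prop where
  measurable : ∀ i j, Measurable fun ω => M ω i j
  indep : iIndepFun (fun i ω => (fun j => M ω i j : Fin d → ℝ)) P
  identDistrib : ∀ i i', IdentDistrib (fun ω => (fun j => M ω i j : Fin d → ℝ))
    (fun ω => (fun j => M ω i' j : Fin d → ℝ)) P P
  centered : ∀ i j, ∫ ω, M ω i j ∂P = 0
  subGaussian : ∀ i (v : Fin d → ℝ), l2norm v = 1 →
    HasSubgaussianMGF (fun ω => ∑ j, M ω i j * v j) (L ^ 2) P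
  covariance : ∀ i j k, cov[fun ω => M ω i j, fun ω => M ω i k; P] = Sig j k

/-- The entries of the noise vector are i.i.d. centered sub-Gaussian with parameter `ϱ`. -/
structure IsSubGaussianNoise {Ω : Type*} [MeasurableSpace Ω] (P : Measure Ω) {n : ℕ}
    (ε : Ω → Fin n → ℝ) (ϱ : ℝ≥0) : Prop where
  measurable : ∀ i, Measurable fun ω => ε ω i
  indep : iIndepFun (fun i ω => ε ω i) P
  identDistrib : ∀ i i', IdentDistrib (fun ω => ε ω i) (fun ω => ε ω i') P P
  centered : ∀ i, ∫ ω, ε ω i ∂P = 0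
  subGaussian : ∀ i, HasSubgaussianMGF (fun ω => ε ω i) (ϱ ^ 2) P

/-! ### The population quantities and the conditions -/

/-- `ŷ = -Σ z`. -/
def yHat {d : ℕ} (Sig : Matrix (Fin d) (Fin d) ℝ) (z : Fin d → ℝ) : Fin d → ℝ := -(Sig *ᵥ z)

/-- `Ŷ₁₁ = -ŷ_Sᵀ x_S`, where `S` is the support of `x`. -/
def YHat {d : ℕ} (Sig : Matrix (Fin d) (Fin d) ℝ) (z x : Fin d → ℝ) : ℝ :=
  -(sub (supp x) (yHat Sig z) ⬝ᵥ sub (supp x) x)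

/-- `f(v) = √(‖v‖² / (vᵀ x_S)² - 1/σ)` for vectors `v` indexed by the support `S` of `x`. -/
def fFun {d : ℕ} (σ : ℕ) (x : Fin d → ℝ) (v : supp x → ℝ) : ℝ :=
  √(l2norm v ^ 2 / (v ⬝ᵥ sub (supp x) x) ^ 2 - 1 / (σ : ℝ))

/-- `λ_n = B₂ L √((ϱ² + L² ‖z‖²) log d / n)`. -/
def lamN {d : ℕ} (B₂ L ϱ : ℝ) (n : ℕ) (z : Fin d → ℝ) : ℝ :=
  B₂ * L * √((ϱ ^ 2 + L ^ 2 * l2norm z ^ 2) * Real.log d / n)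

/-- `μ̂₃ = (1/σ) {λ_min(Σ_SS) - δ + min_{i ∈ S} (-ŷ_S - Σ_SS x_S)_i / x_i - λ_n
- B₁ L² √(σ log d / n) - c₁ L² √(σ / n)}`. -/
def muHat3 {d : ℕ} (c₁ B₁ B₂ L ϱ δ : ℝ) (n σ : ℕ) (Sig : Matrix (Fin d) (Fin d) ℝ)
    (z x : Fin d → ℝ) : ℝ :=
  1 / (σ : ℝ) * (lambdaMin (block (supp x) (supp x) Sig) - δ
    + (⨅ i : supp x, (-(sub (supp x) (yHat Sig z))
        - block (supp x) (supp x) Sig *ᵥ sub (supp x) x) i / x i)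
    - lamN B₂ L ϱ n z - B₁ * L ^ 2 * √(σ * Real.log d / n) - c₁ * L ^ 2 * √((σ : ℝ) / n))

/-- `γ_n = (1/δ) (f(ŷ_S) + ℓ λ_n)² (‖ŷ_{Sᶜ}‖_∞ + λ_n)²`. -/
def gammaN {d : ℕ} (B₂ L ϱ δ ℓ : ℝ) (n σ : ℕ) (Sig : Matrix (Fin d) (Fin d) ℝ)
    (z x : Fin d → ℝ) : ℝ :=
  1 / δ * (fFun σ x (sub (supp x) (yHat Sig z)) + ℓ * lamN B₂ L ϱ n z) ^ 2
    * (infNorm (sub (supp x)ᶜ (yHat Sig z)) + lamN B₂ L ϱ n z) ^ 2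

/-- The function `f` is `ℓ/√σ`-Lipschitz continuous at the point `ŷ_S`. -/
def CondD1 {d : ℕ} (ℓ : ℝ) (σ : ℕ) (Sig : Matrix (Fin d) (Fin d) ℝ) (z x : Fin d → ℝ) : Prop :=
  ∀ᶠ v in 𝓝 (sub (supp x) (yHat Sig z)),
    |fFun σ x v - fFun σ x (sub (supp x) (yHat Sig z))|
      ≤ ℓ / √(σ : ℝ) * l2norm (v - sub (supp x) (yHat Sig z))

/-- `‖Σ_{S,Sᶜ} + (1/σ) x_S ŷ_{Sᶜ}ᵀ‖_∞ + B L² √(log d / n) + λ_n / σ ≤ μ̂₃`. -/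
def CondD2 {d : ℕ} (c₁ B B₁ B₂ L ϱ δ : ℝ) (n σ : ℕ) (Sig : Matrix (Fin d) (Fin d) ℝ)
    (z x : Fin d → ℝ) : Prop :=
  maxNorm (block (supp x) (supp x)ᶜ Sig
      + (1 / (σ : ℝ)) • Matrix.vecMulVec (sub (supp x) x) (sub (supp x)ᶜ (yHat Sig z)))
    + B * L ^ 2 * √(Real.log d / n) + 1 / (σ : ℝ) * lamN B₂ L ϱ n z
  ≤ muHat3 c₁ B₁ B₂ L ϱ δ n σ Sig z x

/-- For some `μ₂ ≤ -λ_min(Σ_SS) - c₁ L² √(σ/n) + δ`,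
`‖Σ_{Sᶜ,Sᶜ} + μ₂ I‖_∞ + B L² √(log d / n) + (‖ŷ_{Sᶜ}‖_∞ + λ_n)² / (Ŷ₁₁ - σ λ_n) + γ_n ≤ μ̂₃`. -/
def CondD3 {d : ℕ} (c₁ B B₁ B₂ L ϱ δ ℓ : ℝ) (n σ : ℕ) (Sig : Matrix (Fin d) (Fin d) ℝ)
    (z x : Fin d → ℝ) : Prop :=
  ∃ μ₂ : ℝ, μ₂ ≤ -lambdaMin (block (supp x) (supp x) Sig) - c₁ * L ^ 2 * √((σ : ℝ) / n) + δ ∧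
    maxNorm (block (supp x)ᶜ (supp x)ᶜ Sig + μ₂ • (1 : Matrix _ _ ℝ))
      + B * L ^ 2 * √(Real.log d / n)
      + (infNorm (sub (supp x)ᶜ (yHat Sig z)) + lamN B₂ L ϱ n z) ^ 2
          / (YHat Sig z x - σ * lamN B₂ L ϱ n z)
      + gammaN B₂ L ϱ δ ℓ n σ Sig z x
    ≤ muHat3 c₁ B₁ B₂ L ϱ δ n σ Sig z x

end

end SILS

/-! The proof builds a dual certificate from the data and shows by concentration that it is valid.
Write `H = MᵀM/n` and `y = -Mᵀb/n`. Suppose a positive definite `N = H + diag (μ₂ + p) + V`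
satisfies `N x = -y`, where `μ₂`, `p`, `V` are multipliers for the trace, diagonal and absolute-sum
constraints. Bordering `N` by `y` and `-yᵀx` gives a positive semidefinite matrix with kernel
spanned by `(1, x)`. Its pairing with a feasible `W` is at most the cost gap of `W`, so a zero gap
forces `W = lift x` (`recovers_of_certificate`).

`N` is chosen block by block in `recovers_of_bounds`. On the support it is `H + μ₃ x xᵀ` plus a
diagonal that enforces `N x = -y`; the cross blocks have rank one; off the support it is a multiple
of `y yᵀ` plus a small multiple of the identity. `certificate_pos` shows, by completing a square and
a Schur-complement bound, that the weight `1/Y + φ/δ` on `y yᵀ` suffices, where `φ` bounds the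
squared ratio of the component of `y_S` orthogonal to `x_S` to the one along it, suitably
normalised. This ratio is `fFun`. The remaining requirement, entries of `V` at most `μ₃`, is D2 on
the cross blocks and D3 off the support.

`recovers_of_deviation` passes from population to empirical quantities. The delicate term is `fFun`:
D1 controls it only in a neighbourhood of unknown size, while the sampling error has a fixed size.
`fFun_le_of_eventually` bridges this using the explicit form of `fFun` along a worst direction.

For the probability, products of sub-Gaussian variables obey a Bernstein inequality
(`measure_abs_average_mul_sub_ge_le`). It controls `y`, the entries of `H`, the vector `H x`, and,
through a half-net, the quadratic form of `H` on the support. A union bound in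
`measure_not_recovers_le` finishes, once the signal condition has been turned into a lower bound on
`n` by a multiple of `σ log d`. -/

namespace SILS

/-! ### Weak duality for the semidefinite program -/

/-- The quadratic form of `N` expands along `u = h + t x` when `N x = -y`. -/
lemma quadForm_sub_smul {ι : Type*} [Fintype ι] {N : Matrix ι ι ℝ} (hN : N.IsSymm)
    {x y : ι → ℝ} (hx : N *ᵥ x = -y) (u : ι → ℝ) (t : ℝ) :
    (u - t • x) ⬝ᵥ N *ᵥ (u - t • x) = u ⬝ᵥ N *ᵥ u + 2 * t * (y ⬝ᵥ u) - t ^ 2 * (y ⬝ᵥ x) := by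
  have h1 : x ⬝ᵥ N *ᵥ u = -(y ⬝ᵥ u) := by
    rw [Matrix.dotProduct_mulVec, ← Matrix.mulVec_transpose, hN.eq, hx, neg_dotProduct]
  simp only [Matrix.mulVec_sub, Matrix.mulVec_smul, hx, sub_dotProduct, dotProduct_sub,
    smul_dotProduct, dotProduct_smul, h1, smul_eq_mul, dotProduct_neg, smul_neg]
  rw [dotProduct_comm u y, dotProduct_comm x y]
  ring

lemma isFeasible_lift {d σ : ℕ} {x : Fin d → ℝ} (hx : IsTernary x) (hσ : (supp x).card = σ) :
    IsFeasible σ (lift x) := by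
  have hsq : ∀ i, x i * x i = if x i ≠ 0 then 1 else 0 := by
    intro i; rcases hx i with h | h | h <;> simp [h]
  have habs : ∀ i, |x i| = if x i ≠ 0 then 1 else 0 := by
    intro i; rcases hx i with h | h | h <;> simp [h]
  refine ⟨?_, ?_, ?_, ?_, ?_⟩
  · have := Matrix.posSemidef_vecMulVec_self_star (Fin.cons 1 x : Fin (d + 1) → ℝ)
    simpa [lift] using this
  · simp [lift, vecMulVec_apply]
  · simp only [lift, dropFirst, Matrix.trace, Matrix.diag, submatrix_apply, vecMulVec_apply,
      Fin.cons_succ, hsq]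
    rw [← hσ, supp, Finset.card_filter]; push_cast; rfl
  · simp only [lift, dropFirst, submatrix_apply, vecMulVec_apply, Fin.cons_succ, abs_mul]
    rw [← Finset.sum_mul_sum]
    simp only [habs]
    rw [← hσ, supp, Finset.card_filter]; push_cast; rw [sq]
  · intro i
    simp only [lift, dropFirst, submatrix_apply, vecMulVec_apply, Fin.cons_succ, hsq]
    split_ifs <;> norm_num

lemma sum_sq_eq_card {d σ : ℕ} {x : Fin d → ℝ} (hx : IsTernary x) (hσ : (supp x).card = σ) :
    x ⬝ᵥ x = σ := by
  have := (isFeasible_lift hx hσ).trace_eq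
  simpa [lift, dropFirst, Matrix.trace, vecMulVec_apply, dotProduct] using this

/-- The cost in terms of the Gram matrix of `M` and the correlation vector `y`. -/
lemma cost_eq {n d : ℕ} (M : Matrix (Fin n) (Fin d) ℝ) (b : Fin n → ℝ)
    (W : Matrix (Fin (d + 1)) (Fin (d + 1)) ℝ) {H : Matrix (Fin d) (Fin d) ℝ} {y : Fin d → ℝ}
    (hH : H = (1 / (n : ℝ)) • (Mᵀ * M)) (hy : y = -((1 / (n : ℝ)) • (Mᵀ *ᵥ b))) :
    cost M b W = 1 / (n : ℝ) * (b ⬝ᵥ b) * W 0 0 + ∑ j, y j * (W 0 j.succ + W j.succ 0)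
      + ∑ i, ∑ j, H i j * dropFirst W j i := by
  have h00 : ((augMatrix M b)ᵀ * augMatrix M b) 0 0 = b ⬝ᵥ b := by
    simp [augMatrix, Matrix.mul_apply, dotProduct]
  have h0s : ∀ j : Fin d, 1 / (n : ℝ) * ((augMatrix M b)ᵀ * augMatrix M b) 0 j.succ = y j := by
    intro j
    simp only [augMatrix, Matrix.mul_apply, hy, Pi.neg_apply, Pi.smul_apply, mulVec, dotProduct,
      transpose_apply, of_apply, Fin.cons_zero, Fin.cons_succ, smul_eq_mul]
    rw [← mul_neg, ← Finset.sum_neg_distrib]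
    congr 1; exact Finset.sum_congr rfl fun _ _ => by ring
  have hs0 : ∀ j : Fin d, 1 / (n : ℝ) * ((augMatrix M b)ᵀ * augMatrix M b) j.succ 0 = y j := by
    intro j
    simp only [augMatrix, Matrix.mul_apply, hy, Pi.neg_apply, Pi.smul_apply, mulVec, dotProduct,
      transpose_apply, of_apply, Fin.cons_zero, Fin.cons_succ, smul_eq_mul]
    rw [← mul_neg, ← Finset.sum_neg_distrib]
    congr 1; exact Finset.sum_congr rfl fun _ _ => by ring
  have hss : ∀ i j : Fin d,
      1 / (n : ℝ) * ((augMatrix M b)ᵀ * augMatrix M b) i.succ j.succ = H i j := by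
    intro i j
    simp [augMatrix, Matrix.mul_apply, hH]
  rw [cost, Matrix.trace]
  simp only [Matrix.diag, Matrix.mul_apply (N := W), Fin.sum_univ_succ (n := d), mul_add,
    Finset.mul_sum, Finset.sum_add_distrib, ← mul_assoc, h0s, hs0, hss, h00, dropFirst,
    submatrix_apply]
  ring

lemma IsTernary.mul_self {d : ℕ} {x : Fin d → ℝ} (hx : IsTernary x) {i : Fin d} (hi : x i ≠ 0) :
    x i * x i = 1 := by
  rcases hx i with h | h | h
  · exact absurd h hi
  · rw [h]; norm_num
  · rw [h]; norm_num

lemma IsTernary.abs_eq {d : ℕ} {x : Fin d → ℝ} (hx : IsTernary x) (i : Fin d) :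
    |x i| = x i * x i := by
  rcases hx i with h | h | h <;> rw [h] <;> norm_num

/-- The linear functional `W ↦ tr (Q W)`, where `Q = [[-yᵀx, yᵀ], [y, N]]`. -/
noncomputable def dualForm {d : ℕ} (N : Matrix (Fin d) (Fin d) ℝ) (x y : Fin d → ℝ)
    (W : Matrix (Fin (d + 1)) (Fin (d + 1)) ℝ) : ℝ :=
  -(y ⬝ᵥ x) * W 0 0 + ∑ j, y j * (W 0 j.succ + W j.succ 0)
      + ∑ i, ∑ j, N i j * dropFirst W j i

/-- The relation `N x = -y` puts `(1, x)` in the kernel of the bordered matrix. Subtracting `v 0`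
times `(1, x)` from `v` therefore leaves the form unchanged and kills the first coordinate, so only
the block `N` is seen. -/
lemma dualForm_vecMulVec {d : ℕ} {N : Matrix (Fin d) (Fin d) ℝ} {x y : Fin d → ℝ}
    (hN : N.IsSymm) (hNx : N *ᵥ x = -y) (v : Fin (d + 1) → ℝ) :
    dualForm N x y (vecMulVec v v)
      = (Fin.tail v - v 0 • x) ⬝ᵥ N *ᵥ (Fin.tail v - v 0 • x) := by
  rw [quadForm_sub_smul hN hNx]
  simp only [dualForm, vecMulVec_apply, dropFirst, submatrix_apply, dotProduct, mulVec, Fin.tail,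
    Finset.mul_sum]
  have h1 : ∑ j, y j * (v 0 * v j.succ + v j.succ * v 0) = ∑ j, 2 * v 0 * (y j * v j.succ) :=
    Finset.sum_congr rfl fun _ _ => by ring
  have h2 : ∑ i, ∑ j, N i j * (v j.succ * v i.succ)
      = ∑ i, ∑ j, v i.succ * (N i j * v j.succ) :=
    Finset.sum_congr rfl fun _ _ => Finset.sum_congr rfl fun _ _ => by ring
  rw [h1, h2, ← Finset.mul_sum]
  rw [← Finset.mul_sum]
  ring

lemma dualForm_sum {d : ℕ} (N : Matrix (Fin d) (Fin d) ℝ) (x y : Fin d → ℝ) {m : ℕ}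
    (W : Fin m → Matrix (Fin (d + 1)) (Fin (d + 1)) ℝ) :
    dualForm N x y (∑ k, W k) = ∑ k, dualForm N x y (W k) := by
  simp only [dualForm, Finset.sum_add_distrib]
  congr 1
  · congr 1
    · rw [Matrix.sum_apply, Finset.mul_sum]
    · symm
      rw [Finset.sum_comm]
      refine Finset.sum_congr rfl fun j _ => ?_
      rw [Matrix.sum_apply, Matrix.sum_apply, ← Finset.sum_add_distrib, Finset.mul_sum]
  · symm
    rw [Finset.sum_comm]
    refine Finset.sum_congr rfl fun i _ => ?_
    rw [Finset.sum_comm]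
    refine Finset.sum_congr rfl fun j _ => ?_
    simp only [dropFirst, submatrix_apply]
    rw [Matrix.sum_apply, Finset.mul_sum]

/-- On positive semidefinite matrices the dual form is nonnegative and vanishes only on multiples
of `lift x`. -/
lemma dualForm_nonneg {d : ℕ} {N : Matrix (Fin d) (Fin d) ℝ} {x y : Fin d → ℝ}
    (hN : N.IsSymm) (hNx : N *ᵥ x = -y) (hpos : ∀ h : Fin d → ℝ, h ≠ 0 → 0 < h ⬝ᵥ N *ᵥ h)
    {W : Matrix (Fin (d + 1)) (Fin (d + 1)) ℝ} (hW : W.PosSemidef) :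
    0 ≤ dualForm N x y W ∧ (dualForm N x y W = 0 → W = W 0 0 • lift x) := by
  have hpsd : ∀ h : Fin d → ℝ, 0 ≤ h ⬝ᵥ N *ᵥ h := by
    intro h
    by_cases h0 : h = 0
    · simp [h0]
    · exact (hpos h h0).le
  obtain ⟨m, v, rfl⟩ := Matrix.posSemidef_iff_eq_sum_vecMulVec.mp hW
  simp only [star_trivial]
  rw [dualForm_sum]
  refine ⟨Finset.sum_nonneg fun k _ => by rw [dualForm_vecMulVec hN hNx]; exact hpsd _,
    fun h0 => ?_⟩
  rw [Finset.sum_eq_zero_iff_of_nonneg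
    (fun k _ => by rw [dualForm_vecMulVec hN hNx]; exact hpsd _)] at h0
  -- Each rank-one piece contributes zero, so strict positivity of `N` makes every factor a multiple
  -- of `(1, x)`.
  have hvi : ∀ k i, v k i = v k 0 * (Fin.cons 1 x : Fin (d + 1) → ℝ) i := by
    intro k i
    have hk := h0 k (Finset.mem_univ _)
    rw [dualForm_vecMulVec hN hNx] at hk
    have hz : Fin.tail (v k) - v k 0 • x = 0 := by
      by_contra hne
      exact (hpos _ hne).ne' hk
    refine Fin.cases ?_ (fun j => ?_) i
    · rw [Fin.cons_zero, mul_one]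
    · have := congrFun hz j
      simp only [Fin.tail, Pi.sub_apply, Pi.smul_apply, smul_eq_mul, Pi.zero_apply] at this
      rw [Fin.cons_succ]; linarith
  ext i j
  simp only [Matrix.sum_apply, vecMulVec_apply, Matrix.smul_apply, lift, smul_eq_mul,
    Finset.sum_mul]
  refine Finset.sum_congr rfl fun k _ => ?_
  rw [hvi k i, hvi k j]; ring

/-- A dual certificate: if the multiplier matrix `N` is positive definite, then the semidefinite
program recovers `x`. -/
theorem recovers_of_certificate {n d σ : ℕ} {M : Matrix (Fin n) (Fin d) ℝ} {b : Fin n → ℝ}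
    {x y p : Fin d → ℝ} {H N V : Matrix (Fin d) (Fin d) ℝ} {μ₂ μ₃ : ℝ}
    (hx : IsTernary x) (hσ : (supp x).card = σ)
    (hH : H = (1 / (n : ℝ)) • (Mᵀ * M)) (hy : y = -((1 / (n : ℝ)) • (Mᵀ *ᵥ b)))
    (hNV : ∀ i j, N i j = H i j + (if i = j then μ₂ + p i else 0) + V i j)
    (hV : ∀ i j, |V i j| ≤ μ₃) (hVx : ∀ i j, x i ≠ 0 → x j ≠ 0 → V i j = μ₃ * (x i * x j))
    (hp : ∀ i, 0 ≤ p i) (hp0 : ∀ i, x i = 0 → p i = 0) (hμ : 0 ≤ μ₃)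
    (hN : N.IsSymm) (hNx : N *ᵥ x = -y) (hpos : ∀ h : Fin d → ℝ, h ≠ 0 → 0 < h ⬝ᵥ N *ᵥ h) :
    Recovers M b σ x := by
  have hfx := isFeasible_lift hx hσ
  have hlift : ∀ i j, dropFirst (lift x) i j = x i * x j := fun i j => by
    simp only [lift, dropFirst, submatrix_apply, vecMulVec_apply, Fin.cons_succ]
  have hcost : ∀ W, dualForm N x y W
      = cost M b W - (1 / (n : ℝ) * (b ⬝ᵥ b) + y ⬝ᵥ x) * W 0 0
      + μ₂ * (dropFirst W).trace + ∑ i, p i * dropFirst W i i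
      + ∑ i, ∑ j, V i j * dropFirst W j i := by
    intro W
    rw [cost_eq M b W hH hy, dualForm]
    simp only [hNV, add_mul, Finset.sum_add_distrib, ite_mul, zero_mul, Finset.sum_ite_eq,
      Finset.mem_univ, if_true, Matrix.trace, Matrix.diag, Finset.mul_sum]
    ring
  have hlift0 : dualForm N x y (lift x) = 0 := by
    rw [lift, dualForm_vecMulVec hN hNx, Fin.tail_cons, Fin.cons_zero, one_smul, sub_self,
      zero_dotProduct]
  have hsupp : ∀ i j, V i j * (x j * x i) = μ₃ * ((x i * x i) * (x j * x j)) := by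
    intro i j
    by_cases hi : x i = 0
    · rw [hi]; ring
    by_cases hj : x j = 0
    · rw [hj]; ring
    rw [hVx i j hi hj]; ring
  -- Complementary slackness: the terms with `p` and `V` are bounded by the diagonal and
  -- absolute-sum constraints, and `lift x` attains both bounds, because `p` vanishes off the
  -- support and `V` equals `μ₃ x xᵀ` on it.
  have hgap : ∀ W, IsFeasible σ W → dualForm N x y W ≤ cost M b W - cost M b (lift x) := by
    intro W hW
    have h1 := hcost W
    have h2 := hcost (lift x)
    rw [hlift0, hfx.corner, hfx.trace_eq] at h2
    rw [hW.corner, hW.trace_eq] at h1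
    have h3 : ∑ i, p i * dropFirst W i i ≤ ∑ i, p i * dropFirst (lift x) i i := by
      refine Finset.sum_le_sum fun i _ => ?_
      by_cases hi : x i = 0
      · rw [hp0 i hi, zero_mul, zero_mul]
      · rw [hlift, hx.mul_self hi]
        exact mul_le_mul_of_nonneg_left (hW.diag_le i) (hp i)
    have h4 : ∑ i, ∑ j, V i j * dropFirst W j i ≤ μ₃ * (σ : ℝ) ^ 2 := by
      calc ∑ i, ∑ j, V i j * dropFirst W j i ≤ ∑ i, ∑ j, μ₃ * |dropFirst W j i| := by
            refine Finset.sum_le_sum fun i _ => Finset.sum_le_sum fun j _ => ?_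
            calc _ ≤ |V i j * dropFirst W j i| := le_abs_self _
              _ = |V i j| * |dropFirst W j i| := abs_mul _ _
              _ ≤ _ := mul_le_mul_of_nonneg_right (hV i j) (abs_nonneg _)
        _ = μ₃ * ∑ j, ∑ i, |dropFirst W j i| := by
            rw [Finset.sum_comm]; simp only [Finset.mul_sum]
        _ ≤ _ := mul_le_mul_of_nonneg_left hW.abs_sum_le hμ
    have h5 : ∑ i, ∑ j, V i j * dropFirst (lift x) j i = μ₃ * (σ : ℝ) ^ 2 := by
      have := sum_sq_eq_card hx hσ
      simp only [dotProduct] at this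
      simp only [hlift, hsupp, ← Finset.mul_sum, ← Finset.sum_mul, this]
      ring
    linarith
  refine ⟨hx, ⟨hfx, fun W hW => ?_⟩, fun W hW => ?_⟩
  · linarith [hgap W hW, (dualForm_nonneg hN hNx hpos hW.posSemidef).1]
  · have h1 := hgap W hW.1
    have h2 := dualForm_nonneg hN hNx hpos hW.1.posSemidef
    have h3 := hW.2 _ hfx
    rw [h2.2 (by linarith [h2.1]), hW.1.corner, one_smul]

/-! ### Construction and positivity of the certificate -/

/-- Positivity of the quadratic form of the multiplier matrix: `g` is the part of a vector on the
support of `x`, and `c`, `s = y ⬝ᵥ c` come from the part off the support. -/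
lemma certificate_pos {ι : Type*} [Fintype ι] {T : Matrix ι ι ℝ} (hT : T.IsSymm)
    {x a y g c : ι → ℝ} {σ Y δ φ τ : ℝ} (hσ : x ⬝ᵥ x = σ) (hσ0 : 0 < σ) (hTx : T *ᵥ x = -a)
    (hY : a ⬝ᵥ x = -Y) (hY0 : 0 < Y) (hδ : 0 < δ) (hτ : 0 < τ)
    (hφ : a ⬝ᵥ a / Y ^ 2 - 1 / σ ≤ φ)
    (hTδ : ∀ u : ι → ℝ, (∀ i, x i = 0 → u i = 0) → δ * (u ⬝ᵥ u) ≤ u ⬝ᵥ T *ᵥ u)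
    (hg : ∀ i, x i = 0 → g i = 0) (hgc : g ≠ 0 ∨ c ≠ 0) :
    0 < g ⬝ᵥ T *ᵥ g - 2 * (1 / σ) * (x ⬝ᵥ g) * (y ⬝ᵥ c) + (1 / Y + φ / δ) * (y ⬝ᵥ c) ^ 2
      + τ * (c ⬝ᵥ c) := by
  by_cases hc : c = 0
  · have hg0 : g ≠ 0 := hgc.resolve_right (fun h => h hc)
    have h1 : 0 < g ⬝ᵥ g := lt_of_le_of_ne
      (Finset.sum_nonneg fun i _ => mul_self_nonneg _)
      (fun h => hg0 (dotProduct_self_eq_zero.mp h.symm))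
    have h2 := hTδ g hg
    simp only [hc, dotProduct_zero]
    nlinarith [mul_pos hδ h1]
  have hc1 : 0 < c ⬝ᵥ c := lt_of_le_of_ne
      (Finset.sum_nonneg fun i _ => mul_self_nonneg _)
      (fun h => hc (dotProduct_self_eq_zero.mp h.symm))
  set s := y ⬝ᵥ c
  set α := (x ⬝ᵥ g) / σ with hα
  set u := g - α • x with hu
  have hxu : x ⬝ᵥ u = 0 := by
    simp only [hu, dotProduct_sub, dotProduct_smul, hσ, smul_eq_mul, hα]; field_simp; ring
  set t := (a ⬝ᵥ u) / Y with ht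
  have hau : a ⬝ᵥ u = t * Y := by rw [ht]; field_simp
  have hQg : g ⬝ᵥ T *ᵥ g = u ⬝ᵥ T *ᵥ u - 2 * α * (t * Y) + α ^ 2 * Y := by
    have h1 := quadForm_sub_smul hT hTx u (-α)
    have h2 : u - (-α) • x = g := by rw [hu]; simp
    rw [h2, hau, hY] at h1; rw [h1]; ring
  -- Coercivity is tested at `u + t x`, the minimiser of the form on the line `u + ℝ x`. The minimum
  -- is the Schur complement of `T` with respect to `x`.
  have hQw : δ * (u ⬝ᵥ u) ≤ u ⬝ᵥ T *ᵥ u - t ^ 2 * Y := by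
    have h1 := quadForm_sub_smul hT hTx u (-t)
    rw [hau, hY] at h1
    have h2 := hTδ (u - (-t) • x) (by
      intro i hi
      simp [hu, hi, hg i hi])
    have h3 : (u - (-t) • x) ⬝ᵥ (u - (-t) • x) = u ⬝ᵥ u + t ^ 2 * σ := by
      simp only [sub_dotProduct, dotProduct_sub, smul_dotProduct, dotProduct_smul, hxu, hσ,
        smul_eq_mul, dotProduct_comm u x]
      ring
    rw [h1, h3] at h2
    nlinarith [mul_nonneg hδ.le (mul_nonneg (sq_nonneg t) hσ0.le)]
  have htu : t ^ 2 ≤ φ * (u ⬝ᵥ u) := by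
    -- `e` is the component of `a` orthogonal to `x`, divided by `Y`. Its squared norm is the
    -- quantity bounded by `φ`.
    set e : ι → ℝ := (1 / Y) • a + (1 / σ) • x with he
    have h1 : e ⬝ᵥ u = t := by
      simp only [he, add_dotProduct, smul_dotProduct, hxu, hau, smul_eq_mul]; field_simp; ring
    have h2 : e ⬝ᵥ e = a ⬝ᵥ a / Y ^ 2 - 1 / σ := by
      simp only [he, add_dotProduct, dotProduct_add, smul_dotProduct, dotProduct_smul, hσ, hY,
        dotProduct_comm x a, smul_eq_mul]
      field_simp; ring
    have h3 : (e ⬝ᵥ u) ^ 2 ≤ (e ⬝ᵥ e) * (u ⬝ᵥ u) := by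
      have := Finset.sum_mul_sq_le_sq_mul_sq Finset.univ e u
      simpa only [dotProduct, ← sq] using this
    have h4 : 0 ≤ u ⬝ᵥ u := Finset.sum_nonneg fun i _ => mul_self_nonneg _
    rw [h1, h2] at h3
    exact h3.trans (mul_le_mul_of_nonneg_right hφ h4)
  have huu : 0 ≤ u ⬝ᵥ u := Finset.sum_nonneg fun i _ => mul_self_nonneg _
  have hφ0 : 0 ≤ φ := by
    by_contra hneg
    push Not at hneg
    have h0 : a ⬝ᵥ a / Y ^ 2 - 1 / σ < 0 := lt_of_le_of_lt hφ hneg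
    have h2 := Finset.sum_mul_sq_le_sq_mul_sq Finset.univ a x
    have h3 : Y ^ 2 ≤ (a ⬝ᵥ a) * σ := by
      have : (a ⬝ᵥ x) ^ 2 ≤ (a ⬝ᵥ a) * (x ⬝ᵥ x) := by simpa only [dotProduct, ← sq] using h2
      rw [hY, hσ] at this; linarith [neg_sq Y]
    have h4 : 1 / σ ≤ a ⬝ᵥ a / Y ^ 2 := by
      rw [div_le_div_iff₀ hσ0 (by positivity)]; linarith
    linarith
  -- The arithmetic-geometric mean inequality together with `t² ≤ φ ‖u‖²`; this is why the weight `φ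
  -- / δ` appears in the lower block.
  have hkey : 2 * (t * s) ≤ δ * (u ⬝ᵥ u) + φ / δ * s ^ 2 := by
    have hA : 0 ≤ δ * (u ⬝ᵥ u) := by positivity
    have hB : 0 ≤ φ / δ * s ^ 2 := by positivity
    have hAB : (δ * (u ⬝ᵥ u)) * (φ / δ * s ^ 2) = φ * (u ⬝ᵥ u) * s ^ 2 := by field_simp
    refine le_of_abs_le (abs_le_of_sq_le_sq' ?_ (by positivity) |> abs_le.mpr)
    nlinarith [mul_le_mul_of_nonneg_right htu (sq_nonneg s),
      sq_nonneg (δ * (u ⬝ᵥ u) - φ / δ * s ^ 2)]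
  have hxg : x ⬝ᵥ g = α * σ := by rw [hα]; field_simp
  -- This square uses up the weight `1 / Y` and all terms in `α`. What remains is the Schur
  -- complement, `-2ts` and the `φ / δ` and `τ` terms.
  have hsq : Y * (α - t - s / Y) ^ 2
      = Y * α ^ 2 + Y * t ^ 2 + s ^ 2 * (1 / Y) - 2 * α * t * Y - 2 * α * s + 2 * t * s := by
    field_simp; ring
  have hsq0 : 0 ≤ Y * (α - t - s / Y) ^ 2 := by positivity
  have hτc := mul_pos hτ hc1
  have h6 : 2 * (1 / σ) * (x ⬝ᵥ g) * s = 2 * α * s := by rw [hxg]; field_simp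
  rw [h6, hQg]
  nlinarith

lemma dotProduct_mulVec_eq_sum {ι : Type*} [Fintype ι] (N : Matrix ι ι ℝ) (u v : ι → ℝ) :
    u ⬝ᵥ N *ᵥ v = ∑ i, ∑ j, u i * N i j * v j := by
  simp only [dotProduct, mulVec, Finset.mul_sum, mul_assoc]

/-- Deterministic recovery: explicit bounds under which a dual certificate exists. -/
theorem recovers_of_bounds {n d σ : ℕ} {M : Matrix (Fin n) (Fin d) ℝ} {b : Fin n → ℝ}
    {x y : Fin d → ℝ} {H : Matrix (Fin d) (Fin d) ℝ} {μ₂ μ₃ θ δ φ τ Y : ℝ}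
    (hx : IsTernary x) (hσ : (supp x).card = σ) (hσ0 : 0 < σ)
    (hH : H = (1 / (n : ℝ)) • (Mᵀ * M)) (hy : y = -((1 / (n : ℝ)) • (Mᵀ *ᵥ b)))
    (hδ : 0 < δ) (hτ : 0 < τ) (hμ : 0 ≤ μ₃) (hY : y ⬝ᵥ x = -Y) (hY0 : 0 < Y)
    (hφ : (∑ i ∈ supp x, y i ^ 2) / Y ^ 2 - 1 / (σ : ℝ) ≤ φ)
    (hθ : ∀ u : Fin d → ℝ, (∀ i, x i = 0 → u i = 0) → θ * (u ⬝ᵥ u) ≤ u ⬝ᵥ H *ᵥ u)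
    (hμ₂ : μ₂ ≤ δ - θ)
    (hq : ∀ i, x i ≠ 0 → σ * μ₃ + δ - θ ≤ (-(y i) - (H *ᵥ x) i) / x i)
    (hcross : ∀ i j, x i ≠ 0 → x j = 0 → |H i j + 1 / (σ : ℝ) * (x i * y j)| ≤ μ₃)
    (hoff : ∀ i j, x i = 0 → x j = 0 →
      |H i j + (if i = j then μ₂ else 0) - (1 / Y + φ / δ) * (y i * y j)
        - (if i = j then τ else 0)| ≤ μ₃) :
    Recovers M b σ x := by
  have hHs : H.IsSymm := by
    rw [hH]; unfold Matrix.IsSymm; simp [Matrix.transpose_smul, Matrix.transpose_mul]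
  have hHsym : ∀ i j, H i j = H j i := fun i j => (hHs.apply j i)
  have hσ' : (0 : ℝ) < σ := by exact_mod_cast hσ0
  have hxx := sum_sq_eq_card hx hσ
  -- The diagonal is forced by the equations `(T x)_i = -y_i` on the support, since `x ⬝ᵥ x = σ`.
  set q : Fin d → ℝ := fun i => (-(y i) - (H *ᵥ x) i) / x i - σ * μ₃ with hqdef
  set a : Fin d → ℝ := fun i => if x i = 0 then 0 else y i with ha
  set T : Matrix (Fin d) (Fin d) ℝ := Matrix.of fun i j =>
    if x i = 0 ∨ x j = 0 then 0 else H i j + μ₃ * (x i * x j) + (if i = j then q i else 0)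
    with hTdef
  -- The factor `1 / σ` in the cross blocks gives `(N x)_i = -y_i` off the support; the lower block
  -- annihilates `x` and can be chosen freely for positivity.
  set N : Matrix (Fin d) (Fin d) ℝ := Matrix.of fun i j =>
    if x i = 0 then
      (if x j = 0 then (1 / Y + φ / δ) * (y i * y j) + (if i = j then τ else 0)
        else -(1 / (σ : ℝ)) * (y i * x j))
    else (if x j = 0 then -(1 / (σ : ℝ)) * (x i * y j) else T i j) with hNdef
  have hTsym : T.IsSymm := by
    ext i j
    simp only [hTdef, transpose_apply, of_apply, or_comm, hHsym j i, mul_comm (x j)]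
    by_cases hij : i = j
    · subst hij; rfl
    · simp only [hij, Ne.symm hij, if_false]
  have hNsym : N.IsSymm := by
    ext i j
    have := hTsym.apply i j
    simp only [hNdef, transpose_apply, of_apply, this, mul_comm (x j), mul_comm (y j)]
    by_cases hij : i = j
    · subst hij; split_ifs <;> rfl
    · simp only [hij, Ne.symm hij, if_false]
      split_ifs <;> ring
  have hTx : T *ᵥ x = -a := by
    ext i
    by_cases hi : x i = 0
    · simp [mulVec, dotProduct, hTdef, ha, hi]
    · have h1 : (T *ᵥ x) i = (H *ᵥ x) i + μ₃ * x i * (x ⬝ᵥ x) + q i * x i := by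
        simp only [mulVec, dotProduct, hTdef, of_apply, hi, false_or, Finset.mul_sum]
        have h2 : q i * x i = ∑ j, (if i = j then q i * x j else 0) := by simp
        rw [h2, ← Finset.sum_add_distrib, ← Finset.sum_add_distrib]
        refine Finset.sum_congr rfl fun j _ => ?_
        by_cases hj : x j = 0
        · simp [hj]
        · simp only [hj, if_false]; split_ifs <;> ring
      rw [h1, hxx]
      simp only [hqdef, ha, Pi.neg_apply, hi, if_false]
      field_simp; ring
  have haY : a ⬝ᵥ x = -Y := by
    rw [← hY]; simp only [dotProduct, ha]
    refine Finset.sum_congr rfl fun i _ => ?_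
    by_cases hi : x i = 0 <;> simp [hi]
  have haa : a ⬝ᵥ a = ∑ i ∈ supp x, y i ^ 2 := by
    rw [supp, Finset.sum_filter]
    simp only [dotProduct, ha]
    refine Finset.sum_congr rfl fun i _ => ?_
    by_cases hi : x i = 0 <;> simp [hi, sq]
  have hNx : N *ᵥ x = -y := by
    ext i
    by_cases hi : x i = 0
    · simp only [mulVec, dotProduct, hNdef, of_apply, hi, if_true, Pi.neg_apply]
      have : ∀ j, (if x j = 0 then (1 / Y + φ / δ) * (y i * y j) + (if i = j then τ else 0)
          else -(1 / (σ : ℝ)) * (y i * x j)) * x j = -(1 / (σ : ℝ)) * y i * (x j * x j) := by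
        intro j
        by_cases hj : x j = 0
        · simp [hj]
        · simp only [hj, if_false]; ring
      simp only [this, ← Finset.mul_sum]
      simp only [dotProduct] at hxx
      rw [hxx]; field_simp
    · have h1 : (N *ᵥ x) i = (T *ᵥ x) i := by
        simp only [mulVec, dotProduct, hNdef, of_apply, hi, if_false]
        refine Finset.sum_congr rfl fun j _ => ?_
        by_cases hj : x j = 0 <;> simp [hj]
      rw [h1, hTx]; simp [ha, hi]
  have hTδ : ∀ u : Fin d → ℝ, (∀ i, x i = 0 → u i = 0) → δ * (u ⬝ᵥ u) ≤ u ⬝ᵥ T *ᵥ u := by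
    intro u hu
    have h1 : u ⬝ᵥ T *ᵥ u = u ⬝ᵥ H *ᵥ u + μ₃ * (u ⬝ᵥ x) ^ 2 + ∑ i, q i * (u i * u i) := by
      have h2 : ∑ i, q i * (u i * u i) = ∑ i, ∑ j, (if i = j then q i * (u i * u j) else 0) := by
        simp
      rw [dotProduct_mulVec_eq_sum, dotProduct_mulVec_eq_sum, h2, sq, dotProduct,
        Finset.sum_mul_sum, Finset.mul_sum, ← Finset.sum_add_distrib, ← Finset.sum_add_distrib]
      refine Finset.sum_congr rfl fun i _ => ?_
      rw [Finset.mul_sum, ← Finset.sum_add_distrib, ← Finset.sum_add_distrib]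
      refine Finset.sum_congr rfl fun j _ => ?_
      by_cases hi : x i = 0
      · simp [hu i hi]
      by_cases hj : x j = 0
      · simp [hu j hj]
      simp only [hTdef, of_apply, hi, hj, or_self, if_false]
      split_ifs <;> ring
    -- `H` supplies `θ` on the support and the diagonal `q` supplies the missing `δ - θ`; the
    -- rank-one term only helps.
    have h3 : (δ - θ) * (u ⬝ᵥ u) ≤ ∑ i, q i * (u i * u i) := by
      rw [dotProduct, Finset.mul_sum]
      refine Finset.sum_le_sum fun i _ => ?_
      by_cases hi : x i = 0
      · simp [hu i hi]
      · refine mul_le_mul_of_nonneg_right ?_ (mul_self_nonneg _)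
        have := hq i hi
        simp only [hqdef]; linarith
    have h4 := hθ u hu
    have h5 : 0 ≤ μ₃ * (u ⬝ᵥ x) ^ 2 := by positivity
    rw [h1]; linarith
  have hpos : ∀ h : Fin d → ℝ, h ≠ 0 → 0 < h ⬝ᵥ N *ᵥ h := by
    intro h h0
    set g : Fin d → ℝ := fun i => if x i = 0 then 0 else h i with hg
    set c : Fin d → ℝ := fun i => if x i = 0 then h i else 0 with hc
    have hgc : g ≠ 0 ∨ c ≠ 0 := by
      by_contra hcon
      push Not at hcon
      apply h0
      ext i
      have h1 := congrFun hcon.1 i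
      have h2 := congrFun hcon.2 i
      simp only [hg, hc, Pi.zero_apply] at h1 h2 ⊢
      by_cases hi : x i = 0
      · simpa [hi] using h2
      · simpa [hi] using h1
    have hmain := certificate_pos (y := y) (c := c) (g := g) (φ := φ) hTsym hxx hσ' hTx haY hY0 hδ hτ
      (by rw [haa]; exact hφ) hTδ (fun i hi => by simp [hg, hi]) hgc
    have hexp : h ⬝ᵥ N *ᵥ h = g ⬝ᵥ T *ᵥ g - 2 * (1 / (σ : ℝ)) * (x ⬝ᵥ g) * (y ⬝ᵥ c)
        + (1 / Y + φ / δ) * (y ⬝ᵥ c) ^ 2 + τ * (c ⬝ᵥ c) := by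
      have e1 : 2 * (1 / (σ : ℝ)) * (x ⬝ᵥ g) * (y ⬝ᵥ c)
          = ∑ i, ∑ j, ((1 / (σ : ℝ)) * (x i * g i) * (y j * c j)
              + (1 / (σ : ℝ)) * (x j * g j) * (y i * c i)) := by
        simp only [Finset.sum_add_distrib]
        rw [Finset.sum_comm (f := fun i j => (1 / (σ : ℝ)) * (x j * g j) * (y i * c i))]
        simp only [← Finset.mul_sum, ← Finset.sum_mul, dotProduct]
        ring
      have e2 : (1 / Y + φ / δ) * (y ⬝ᵥ c) ^ 2
          = ∑ i, ∑ j, (1 / Y + φ / δ) * ((y i * c i) * (y j * c j)) := by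
        simp only [← Finset.mul_sum, ← Finset.sum_mul, dotProduct]; ring
      have e3 : τ * (c ⬝ᵥ c) = ∑ i, ∑ j, (if i = j then τ * (c i * c j) else 0) := by
        simp [dotProduct, Finset.mul_sum]
      rw [dotProduct_mulVec_eq_sum, dotProduct_mulVec_eq_sum, e1, e2, e3,
        ← Finset.sum_sub_distrib, ← Finset.sum_add_distrib, ← Finset.sum_add_distrib]
      refine Finset.sum_congr rfl fun i _ => ?_
      rw [← Finset.sum_sub_distrib, ← Finset.sum_add_distrib, ← Finset.sum_add_distrib]
      refine Finset.sum_congr rfl fun j _ => ?_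
      simp only [hNdef, of_apply, hg, hc]
      by_cases hi : x i = 0 <;> by_cases hj : x j = 0 <;> simp only [hi, hj, if_true, if_false]
      · split_ifs <;> ring
      · split_ifs <;> ring
      · split_ifs <;> ring
      · split_ifs <;> ring
    rw [hexp]; exact hmain
  -- On the support `μ₂ + p` is the diagonal `q`, so that `V`, defined as the remainder, is exactly
  -- `μ₃ x xᵀ` there.
  set p : Fin d → ℝ := fun i => if x i = 0 then 0 else q i - μ₂ with hpdef
  refine recovers_of_certificate (N := N) (p := p) (μ₂ := μ₂)
    (V := fun i j => N i j - H i j - (if i = j then μ₂ + p i else 0)) hx hσ hH hy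
    (fun i j => by ring) ?_ ?_ ?_ (fun i hi => by simp [hpdef, hi]) hμ hNsym hNx hpos
  · have hdiag : ∀ i j, x i ≠ 0 → x j ≠ 0 →
        N i j - H i j - (if i = j then μ₂ + p i else 0) = μ₃ * (x i * x j) := by
      intro i j hi hj
      simp only [hNdef, hTdef, hpdef, of_apply, hi, hj, or_self, if_false]
      split_ifs <;> ring
    intro i j
    by_cases hi : x i = 0
    · by_cases hj : x j = 0
      · rw [← abs_neg]
        convert hoff i j hi hj using 2
        simp only [hNdef, hpdef, of_apply, hi, hj, if_true]
        split_ifs <;> ring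
      · have hij : i ≠ j := fun h => hj (h ▸ hi)
        rw [← abs_neg]
        convert hcross j i hj hi using 2
        simp only [hNdef, of_apply, hi, hj, hij, if_true, if_false, hHsym i j]
        ring
    · by_cases hj : x j = 0
      · have hij : i ≠ j := fun h => hi (h ▸ hj)
        rw [← abs_neg]
        convert hcross i j hi hj using 2
        simp only [hNdef, of_apply, hi, hj, hij, if_true, if_false]
        ring
      · show |N i j - H i j - (if i = j then μ₂ + p i else 0)| ≤ μ₃
        rw [hdiag i j hi hj, abs_mul, abs_mul, hx.abs_eq, hx.abs_eq, hx.mul_self hi,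
          hx.mul_self hj, abs_of_nonneg hμ]
        linarith
  · intro i j hi hj
    simp only [hNdef, hTdef, hpdef, of_apply, hi, hj, or_self, if_false]
    split_ifs <;> ring
  · intro i
    by_cases hi : x i = 0
    · simp [hpdef, hi]
    · have h1 := hq i hi
      simp only [hpdef, hi, if_false, hqdef]; linarith

/-! ### Norms and the smallest eigenvalue -/

lemma le_maxNorm {ι κ : Type*} [Finite ι] [Finite κ] (A : Matrix ι κ ℝ) (i : ι) (j : κ) :
    |A i j| ≤ maxNorm A :=
  (le_ciSup (Set.finite_range fun j => |A i j|).bddAbove j).trans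
    (le_ciSup (f := fun i => ⨆ j, |A i j|) (Set.finite_range _).bddAbove i)

lemma maxNorm_nonneg {ι κ : Type*} (A : Matrix ι κ ℝ) : 0 ≤ maxNorm A :=
  Real.iSup_nonneg fun _ => Real.iSup_nonneg fun _ => abs_nonneg _

lemma le_infNorm {ι : Type*} [Finite ι] (v : ι → ℝ) (i : ι) : |v i| ≤ infNorm v :=
  le_ciSup (f := fun i => |v i|) (Set.finite_range _).bddAbove i

lemma infNorm_nonneg {ι : Type*} (v : ι → ℝ) : 0 ≤ infNorm v :=
  Real.iSup_nonneg fun _ => abs_nonneg _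

lemma l2norm_nonneg {ι : Type*} [Fintype ι] (v : ι → ℝ) : 0 ≤ l2norm v := norm_nonneg _

lemma l2norm_sq {ι : Type*} [Fintype ι] (v : ι → ℝ) : l2norm v ^ 2 = v ⬝ᵥ v := by
  rw [l2norm, EuclideanSpace.norm_sq_eq]
  simp [dotProduct, sq]

lemma l2norm_smul {ι : Type*} [Fintype ι] (t : ℝ) (v : ι → ℝ) :
    l2norm (t • v) = |t| * l2norm v := by
  rw [l2norm, WithLp.toLp_smul, norm_smul, Real.norm_eq_abs, l2norm]

lemma l2norm_add_le {ι : Type*} [Fintype ι] (u v : ι → ℝ) :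
    l2norm (u + v) ≤ l2norm u + l2norm v := by
  rw [l2norm, WithLp.toLp_add]; exact norm_add_le _ _

lemma l2norm_eq_zero {ι : Type*} [Fintype ι] {v : ι → ℝ} : l2norm v = 0 ↔ v = 0 := by
  rw [l2norm, norm_eq_zero, WithLp.toLp_eq_zero]

lemma lambdaMin_mul_le {ι : Type*} [Fintype ι] [DecidableEq ι] {A : Matrix ι ι ℝ}
    (hA : A.IsHermitian) (u : ι → ℝ) : lambdaMin A * (u ⬝ᵥ u) ≤ u ⬝ᵥ A *ᵥ u := by
  open scoped MatrixOrder in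
  have hbdd : BddBelow (spectrum ℝ A) := by
    rw [hA.spectrum_real_eq_range_eigenvalues]
    exact (Set.finite_range _).bddBelow
  have h1 : algebraMap ℝ (Matrix ι ι ℝ) (lambdaMin A) ≤ A := by
    have hsa : IsSelfAdjoint A := hA
    rw [algebraMap_le_iff_le_spectrum hsa]
    exact fun r hr => csInf_le hbdd hr
  have h2 := (Matrix.le_iff.mp h1).dotProduct_mulVec_nonneg u
  rw [star_trivial, Matrix.sub_mulVec, dotProduct_sub, Algebra.algebraMap_eq_smul_one,
    Matrix.smul_mulVec, one_mulVec, dotProduct_smul, smul_eq_mul] at h2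
  linarith

/-! ### From local to macroscopic control of `fFun` -/

section LipschitzAtPoint

variable {d σ : ℕ} {x : Fin d → ℝ}

lemma sub_dotProduct_sub (v x : Fin d → ℝ) : sub (supp x) v ⬝ᵥ sub (supp x) x = v ⬝ᵥ x := by
  simp only [dotProduct, sub]
  rw [Finset.sum_coe_sort (supp x) (fun i => v i * x i), supp, Finset.sum_filter]
  refine Finset.sum_congr rfl fun i _ => ?_
  by_cases h : x i = 0 <;> simp [h]

lemma sub_dotProduct_sub_self (hx : IsTernary x) (hσ : (supp x).card = σ) :
    sub (supp x) x ⬝ᵥ sub (supp x) x = σ := by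
  rw [sub_dotProduct_sub, sum_sq_eq_card hx hσ]

/-- `f` is the ratio of the component orthogonal to `x_S` and the component along `x_S`. -/
lemma fFun_add_smul (hx : IsTernary x) (hσ : (supp x).card = σ) (hσ0 : 0 < σ)
    {w : supp x → ℝ} (hw : w ⬝ᵥ sub (supp x) x = 0) {D : ℝ} (hD : D < 0) :
    fFun σ x (w + (D / σ) • sub (supp x) x) = l2norm w / (-D) := by
  have hσ' : (0 : ℝ) < σ := by exact_mod_cast hσ0
  have hxx := sub_dotProduct_sub_self hx hσ
  rw [fFun, l2norm_sq]
  simp only [add_dotProduct, dotProduct_add, smul_dotProduct, dotProduct_smul, hw, hxx,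
    dotProduct_comm (sub (supp x) x) w, smul_eq_mul]
  rw [← l2norm_sq]
  have : (l2norm w ^ 2 + D / σ * 0 + D / σ * (0 + D / σ * σ)) / (0 + D / σ * σ) ^ 2 - 1 / (σ : ℝ)
      = (l2norm w / (-D)) ^ 2 := by
    have hD' := hD.ne
    have h1 : D / σ * σ = D := by field_simp
    rw [div_pow, neg_sq, mul_zero, zero_add, add_zero, h1]
    field_simp; ring
  rw [this, Real.sqrt_sq (div_nonneg (l2norm_nonneg _) (by linarith))]

/-- The neighbourhood in D1 has unknown size. All that is extracted from it is one positive step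
length along a prescribed direction. -/
lemma exists_pos_le_one_of_eventually {E : Type*} [AddCommGroup E] [Module ℝ E]
    [TopologicalSpace E] [ContinuousAdd E] [ContinuousSMul ℝ E] {p : E → Prop} {v : E}
    (h : ∀ᶠ u in 𝓝 v, p u) (Δ : E) : ∃ t : ℝ, 0 < t ∧ t ≤ 1 ∧ p (v + t • Δ) := by
  have hc : Tendsto (fun t : ℝ => v + t • Δ) (𝓝[>] 0) (𝓝 v) := by
    have : Continuous fun t : ℝ => v + t • Δ := by fun_prop
    have h0 := this.tendsto 0
    simp only [zero_smul, add_zero] at h0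
    exact h0.mono_left nhdsWithin_le_nhds
  have h2 : ∀ᶠ t : ℝ in 𝓝[>] 0, t ∈ Set.Ioc (0 : ℝ) 1 := Ioc_mem_nhdsGT one_pos
  obtain ⟨t, ht, ht'⟩ := ((hc.eventually h).and h2).exists
  exact ⟨t, ht'.1, ht'.2, ht⟩

/-- Lipschitz continuity of `f` at one point, in an arbitrarily small neighbourhood, bounds the
increase of `f` at a macroscopic distance: the derivative of `f` in the worst direction is explicit
and `f` is a ratio of a norm and a linear form. -/
lemma fFun_le_of_eventually (hx : IsTernary x) (hσ : (supp x).card = σ) (hσ0 : 0 < σ)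
    {ℓ r : ℝ} {v₀ v : supp x → ℝ}
    (h : ∀ᶠ v in 𝓝 v₀, |fFun σ x v - fFun σ x v₀| ≤ ℓ / √(σ : ℝ) * l2norm (v - v₀))
    (hv : ∀ i, |v i - v₀ i| ≤ r) (hr : 2 * (σ * r) ≤ -(v₀ ⬝ᵥ sub (supp x) x))
    (hD : v₀ ⬝ᵥ sub (supp x) x < 0) :
    fFun σ x v ≤ fFun σ x v₀ + 3 * (ℓ * r) := by
  have hσ' : (0 : ℝ) < σ := by exact_mod_cast hσ0
  have hsqrt : 0 < √(σ : ℝ) := Real.sqrt_pos.mpr hσ'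
  set X := sub (supp x) x with hX
  have hxx : X ⬝ᵥ X = σ := sub_dotProduct_sub_self hx hσ
  have hXi : ∀ i, |X i| = 1 := by
    intro i
    have : x i ≠ 0 := (Finset.mem_filter.mp i.2).2
    rw [hX, sub, hx.abs_eq, hx.mul_self this]
  have hcard : Fintype.card (supp x) = σ := by rw [Fintype.card_coe, hσ]
  obtain ⟨i₀⟩ : Nonempty (supp x) := by
    rw [← Fintype.card_pos_iff, hcard]; exact hσ0
  have hr0 : 0 ≤ r := (abs_nonneg _).trans (hv i₀)
  -- No sign of `ℓ` is assumed; the Lipschitz bound itself forces it, tested along the nonzero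
  -- direction `X`.
  have hℓ : 0 ≤ ℓ := by
    obtain ⟨t, ht, -, hp⟩ := exists_pos_le_one_of_eventually h X
    have h1 := (abs_nonneg _).trans hp
    rw [add_sub_cancel_left, l2norm_smul, abs_of_pos ht] at h1
    have h2 : 0 < l2norm X := by
      refine lt_of_le_of_ne (l2norm_nonneg _) fun h0 => ?_
      have := l2norm_sq X
      rw [← h0, hxx] at this
      linarith [zero_pow (M₀ := ℝ) two_ne_zero]
    have h3 : 0 ≤ ℓ / √(σ : ℝ) := nonneg_of_mul_nonneg_left h1 (mul_pos ht h2)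
    by_contra hneg
    push Not at hneg
    exact absurd h3 (not_le.mpr (div_neg_of_neg_of_pos hneg hsqrt))
  set Δ := v - v₀ with hΔ
  set η := Δ ⬝ᵥ X with hη
  set A := -(v₀ ⬝ᵥ X) with hA
  have hA0 : 0 < A := by rw [hA]; linarith
  have hηr : |η| ≤ σ * r := by
    calc |η| ≤ ∑ i, |Δ i * X i| := Finset.abs_sum_le_sum_abs _ _
      _ ≤ ∑ _i : supp x, r := by
        refine Finset.sum_le_sum fun i _ => ?_
        rw [abs_mul, hXi, mul_one]; exact hv i
      _ = σ * r := by rw [Finset.sum_const, Finset.card_univ, hcard, nsmul_eq_mul]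
  have hηA : |η| ≤ A / 2 := by linarith
  have hη1 := (abs_le.mp hηA).1
  have hη2 := (abs_le.mp hηA).2
  have hΔr : l2norm Δ ≤ √(σ : ℝ) * r := by
    refine le_of_sq_le_sq ?_ (by positivity)
    rw [l2norm_sq, mul_pow, Real.sq_sqrt hσ'.le]
    calc Δ ⬝ᵥ Δ ≤ ∑ _i : supp x, r ^ 2 := by
          refine Finset.sum_le_sum fun i _ => ?_
          rw [← sq, ← sq_abs]; exact pow_le_pow_left₀ (abs_nonneg _) (hv i) 2
      _ = σ * r ^ 2 := by rw [Finset.sum_const, Finset.card_univ, hcard, nsmul_eq_mul]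
  set w₀ := v₀ + (A / σ) • X with hw₀
  set w := Δ - (η / σ) • X with hw
  have hw₀X : w₀ ⬝ᵥ X = 0 := by
    rw [hw₀, add_dotProduct, smul_dotProduct, hxx, smul_eq_mul, hA]; field_simp; ring
  have hwX : w ⬝ᵥ X = 0 := by
    rw [hw, sub_dotProduct, smul_dotProduct, hxx, smul_eq_mul, ← hη]; field_simp; ring
  have hf₀ : fFun σ x v₀ = l2norm w₀ / A := by
    have := fFun_add_smul hx hσ hσ0 hw₀X (D := -A) (by linarith)
    rw [neg_neg] at this
    rw [← this]; congr 1; rw [hw₀, ← hX]; module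
  have hfv : fFun σ x v ≤ (l2norm w₀ + l2norm w) / (A - η) := by
    have h1 : (w₀ + w) ⬝ᵥ X = 0 := by rw [add_dotProduct, hw₀X, hwX, add_zero]
    have := fFun_add_smul hx hσ hσ0 h1 (D := -(A - η)) (by linarith)
    rw [neg_neg] at this
    have h2 : w₀ + w + (-(A - η) / (σ : ℝ)) • sub (supp x) x = v := by
      rw [hw₀, hw, hΔ, ← hX]; module
    rw [h2] at this
    rw [this]
    exact div_le_div_of_nonneg_right (l2norm_add_le _ _) (by linarith)
  -- `w'` has the length of `w` but points along `w₀`, so that norms add exactly. If `w₀ = 0` there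
  -- is nothing to align and `w` itself serves.
  obtain ⟨w', hw'X, hw'n, hw'a⟩ : ∃ w' : supp x → ℝ, w' ⬝ᵥ X = 0 ∧ l2norm w' = l2norm w ∧
      ∀ t : ℝ, 0 ≤ t → l2norm (w₀ + t • w') = l2norm w₀ + t * l2norm w := by
    by_cases h0 : w₀ = 0
    · refine ⟨w, hwX, rfl, fun t ht => ?_⟩
      rw [h0, zero_add, l2norm_smul, abs_of_nonneg ht, l2norm_eq_zero.mpr rfl, zero_add]
    · have hpos : 0 < l2norm w₀ :=
        lt_of_le_of_ne (l2norm_nonneg _) fun h => h0 (l2norm_eq_zero.mp h.symm)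
      refine ⟨(l2norm w / l2norm w₀) • w₀, ?_, ?_, fun t ht => ?_⟩
      · rw [smul_dotProduct, hw₀X, smul_zero]
      · rw [l2norm_smul, abs_of_nonneg (div_nonneg (l2norm_nonneg _) hpos.le)]; field_simp
      · have : w₀ + t • (l2norm w / l2norm w₀) • w₀ = (1 + t * (l2norm w / l2norm w₀)) • w₀ := by
          module
        have h5 : 0 ≤ 1 + t * (l2norm w / l2norm w₀) := by
          have := div_nonneg (l2norm_nonneg w) hpos.le
          positivity
        rw [this, l2norm_smul, abs_of_nonneg h5]; field_simp
  -- The test direction has the length of `Δ` and the same component along `X`; only its orthogonal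
  -- part is rotated into the worst position.
  set Δ' := w' + (η / σ) • X with hΔ'
  have hΔ'n : l2norm Δ' = l2norm Δ := by
    have h1 : l2norm Δ' ^ 2 = l2norm Δ ^ 2 := by
      have h2 : Δ = w + (η / σ) • X := by rw [hw]; module
      rw [h2, hΔ', l2norm_sq, l2norm_sq]
      simp only [add_dotProduct, dotProduct_add, smul_dotProduct, dotProduct_smul, hwX, hw'X,
        dotProduct_comm X w, dotProduct_comm X w', ← l2norm_sq, hw'n]
    exact (sq_eq_sq₀ (l2norm_nonneg _) (l2norm_nonneg _)).mp h1
  obtain ⟨t, ht0, ht1, hp⟩ := exists_pos_le_one_of_eventually h Δ'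
  have htη : |t * η| ≤ A / 2 := by
    rw [abs_mul, abs_of_pos ht0]
    exact (mul_le_of_le_one_left (abs_nonneg _) ht1).trans hηA
  have htη1 := (abs_le.mp htη).1
  have htη2 := (abs_le.mp htη).2
  have hft : fFun σ x (v₀ + t • Δ') = (l2norm w₀ + t * l2norm w) / (A - t * η) := by
    have h1 : (w₀ + t • w') ⬝ᵥ X = 0 := by
      rw [add_dotProduct, smul_dotProduct, hw₀X, hw'X, smul_zero, add_zero]
    have := fFun_add_smul hx hσ hσ0 h1 (D := -(A - t * η)) (by linarith)
    rw [neg_neg, hw'a t ht0.le] at this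
    rw [← this]; congr 1; rw [hw₀, hΔ', ← hX]; module
  rw [add_sub_cancel_left, l2norm_smul, abs_of_pos ht0, hΔ'n, hft, hf₀] at hp
  have hp1 := (le_abs_self _).trans hp
  set N := l2norm w₀
  set ρ := l2norm w
  have hm : ℓ / √(σ : ℝ) * (t * l2norm Δ) ≤ t * (ℓ * r) := by
    have : ℓ / √(σ : ℝ) * l2norm Δ ≤ ℓ * r := by
      calc ℓ / √(σ : ℝ) * l2norm Δ ≤ ℓ / √(σ : ℝ) * (√(σ : ℝ) * r) := by gcongr
        _ = ℓ * r := by field_simp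
    nlinarith
  have hℓr : 0 ≤ ℓ * r := mul_nonneg hℓ hr0
  have hdiff : (N + t * ρ) / (A - t * η) - N / A = t * ((ρ * A + N * η) / (A * (A - t * η))) := by
    have : A - t * η ≠ 0 := by linarith
    field_simp; ring
  -- After division by `t` the numerator `ρ A + N η` no longer depends on `t`, so a bound at one
  -- small step transfers to the full step.
  have hkey : ρ * A + N * η ≤ ℓ * r * (A * (A - t * η)) := by
    rw [hdiff] at hp1
    have := le_of_mul_le_mul_left (hp1.trans hm) ht0
    rwa [div_le_iff₀ (mul_pos hA0 (by linarith))] at this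
  have hAη : 0 < A - η := by linarith
  have hdiff2 : (N + ρ) / (A - η) - N / A = (ρ * A + N * η) / (A * (A - η)) := by
    field_simp; ring
  have hfin : (ρ * A + N * η) / (A * (A - η)) ≤ 3 * (ℓ * r) := by
    rw [div_le_iff₀ (mul_pos hA0 hAη)]
    -- The constant `3` arises from `A - tη ≤ 3A/2` and `A - η ≥ A/2`.
    have h1 : A * (A - t * η) ≤ 3 * (A * (A - η)) := by nlinarith
    calc _ ≤ ℓ * r * (A * (A - t * η)) := hkey
      _ ≤ ℓ * r * (3 * (A * (A - η))) := mul_le_mul_of_nonneg_left h1 hℓr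
      _ = _ := by ring
  rw [hf₀]; linarith

end LipschitzAtPoint

/-! ### Deterministic recovery from deviation bounds -/

lemma YHat_eq {d : ℕ} (Sig : Matrix (Fin d) (Fin d) ℝ) (z x : Fin d → ℝ) :
    YHat Sig z x = x ⬝ᵥ Sig *ᵥ z := by
  rw [YHat, sub_dotProduct_sub, yHat, neg_dotProduct, neg_neg, dotProduct_comm]

lemma supp_nonempty_of_YHat_pos {d : ℕ} {Sig : Matrix (Fin d) (Fin d) ℝ} {z x : Fin d → ℝ}
    (h : 0 < YHat Sig z x) : (supp x).Nonempty := by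
  rw [Finset.nonempty_iff_ne_empty]
  intro h0
  have hx : x = 0 := by
    ext i
    by_contra hi
    have : i ∈ supp x := Finset.mem_filter.mpr ⟨Finset.mem_univ i, hi⟩
    rw [h0] at this
    exact absurd this (Finset.notMem_empty i)
  rw [YHat_eq, hx, zero_dotProduct] at h
  exact lt_irrefl _ h

/-- Recovery when the empirical quantities are close to the population quantities. -/
theorem recovers_of_deviation {n d σ : ℕ} {M : Matrix (Fin n) (Fin d) ℝ} {b : Fin n → ℝ}
    {z x y : Fin d → ℝ} {Sig H : Matrix (Fin d) (Fin d) ℝ} {c₁ B B₁ B₂ L ϱ δ ℓ : ℝ}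
    (hx : IsTernary x) (hσ : (supp x).card = σ) (hc₁ : 0 ≤ c₁)
    (hH : H = (1 / (n : ℝ)) • (Mᵀ * M)) (hy : y = -((1 / (n : ℝ)) • (Mᵀ *ᵥ b)))
    (hδ : 0 < δ) (hY0 : 0 < YHat Sig z x) (hSig : Sig.IsSymm)
    (hD1 : CondD1 ℓ σ Sig z x) (hD2 : CondD2 c₁ B B₁ B₂ L ϱ δ n σ Sig z x)
    (hD3 : CondD3 c₁ B B₁ B₂ L ϱ δ ℓ n σ Sig z x)
    (hlam0 : 0 ≤ lamN B₂ L ϱ n z) (hlam : 2 * (σ * lamN B₂ L ϱ n z) ≤ YHat Sig z x)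
    (hB : 0 < B * L ^ 2 * √(Real.log d / n))
    (hdev_y : ∀ i, |y i - yHat Sig z i| ≤ lamN B₂ L ϱ n z / 3)
    (hdev_entry : ∀ i j, |H i j - Sig i j| ≤ B * L ^ 2 * √(Real.log d / n) / 2)
    (hdev_x : ∀ i, |((H - Sig) *ᵥ x) i| ≤ B₁ * L ^ 2 * √(σ * Real.log d / n))
    (hdev_op : ∀ u : Fin d → ℝ, (∀ i, x i = 0 → u i = 0) →
      |u ⬝ᵥ (H - Sig) *ᵥ u| ≤ c₁ * L ^ 2 * √((σ : ℝ) / n) * (u ⬝ᵥ u)) :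
    Recovers M b σ x := by
  obtain ⟨μ₂, hμ₂, hD3⟩ := hD3
  set lam := lamN B₂ L ϱ n z with hlamdef
  set β := B * L ^ 2 * √(Real.log d / n) with hβ
  set yh := yHat Sig z with hyh
  set Yh := YHat Sig z x with hYh
  set θ₀ := lambdaMin (block (supp x) (supp x) Sig) with hθ₀
  set c := c₁ * L ^ 2 * √((σ : ℝ) / n) with hc
  set μ₃ := muHat3 c₁ B₁ B₂ L ϱ δ n σ Sig z x with hμ₃
  set f₀ := fFun σ x (sub (supp x) yh) with hf₀
  have hc0 : 0 ≤ c := by positivity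
  have hmem : ∀ i, x i ≠ 0 → i ∈ supp x := fun i hi => by simp [supp, hi]
  have hmemc : ∀ i, x i = 0 → i ∈ (supp x)ᶜ := fun i hi => by simp [supp, hi]
  have hσ0 : 0 < σ := hσ ▸ (supp_nonempty_of_YHat_pos hY0).card_pos
  have hσ' : (0 : ℝ) < σ := by exact_mod_cast hσ0
  have hsum : ∀ v : Fin d → ℝ, sub (supp x) v ⬝ᵥ sub (supp x) x = v ⬝ᵥ x :=
    fun v => sub_dotProduct_sub v x
  have hYhx : yh ⬝ᵥ x = -Yh := by rw [hYh, YHat, hsum, neg_neg]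
  have hyx : |y ⬝ᵥ x - yh ⬝ᵥ x| ≤ σ * (lam / 3) := by
    rw [← hsum, ← hsum, ← sub_dotProduct]
    calc |(sub (supp x) y - sub (supp x) yh) ⬝ᵥ sub (supp x) x|
        ≤ ∑ i : supp x, |(sub (supp x) y - sub (supp x) yh) i * sub (supp x) x i| :=
          Finset.abs_sum_le_sum_abs _ _
      _ ≤ ∑ _i : supp x, lam / 3 := by
        refine Finset.sum_le_sum fun i _ => ?_
        have hi : x i ≠ 0 := (Finset.mem_filter.mp i.2).2
        simp only [sub, Pi.sub_apply]
        rw [abs_mul, hx.abs_eq, hx.mul_self hi, mul_one]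
        exact hdev_y i
      _ = σ * (lam / 3) := by
        rw [Finset.sum_const, Finset.card_univ, Fintype.card_coe, hσ, nsmul_eq_mul]
  have hσlam : 0 ≤ σ * lam := by positivity
  set Y := -(y ⬝ᵥ x) with hYdef
  have hYge : Yh - σ * lam ≤ Y := by
    have := (abs_le.mp hyx).2
    rw [hYhx] at this
    rw [hYdef]; nlinarith
  have hYh' : 0 < Yh - σ * lam := by linarith
  have hY : 0 < Y := by linarith
  set g := infNorm (sub (supp x)ᶜ yh) + lam with hg
  have hg0 : 0 ≤ g := add_nonneg (infNorm_nonneg _) hlam0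
  have hyg : ∀ i, x i = 0 → |y i| ≤ g := by
    intro i hi
    have h1 : |yh i| ≤ infNorm (sub (supp x)ᶜ yh) := le_infNorm (sub (supp x)ᶜ yh) ⟨i, hmemc i hi⟩
    have h2 := hdev_y i
    have h3 : |y i| ≤ |yh i| + |y i - yh i| := by
      have := abs_add_le (yh i) (y i - yh i)
      rwa [add_sub_cancel] at this
    rw [hg]; linarith
  set φ := (f₀ + ℓ * lam) ^ 2 with hφ
  -- Requiring deviation `lam / 3` for `y` absorbs the factor `3` lost in the passage from local to
  -- macroscopic.
  have hfle : fFun σ x (sub (supp x) y) ≤ f₀ + ℓ * lam := by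
    have := fFun_le_of_eventually hx hσ hσ0 (v := sub (supp x) y) (r := lam / 3) hD1
      (fun i => hdev_y i) (by rw [hsum, hYhx]; linarith) (by rw [hsum, hYhx]; linarith)
    rw [← hyh, ← hf₀] at this
    linarith
  have hgam : gammaN B₂ L ϱ δ ℓ n σ Sig z x = φ / δ * g ^ 2 := by
    rw [gammaN]; ring
  have hφ0 : 0 ≤ φ / δ := by positivity
  rw [hgam] at hD3
  have hfrac : 0 ≤ g ^ 2 / (Yh - σ * lam) := by positivity
  have hμ0 : 0 ≤ μ₃ := by
    have h1 := maxNorm_nonneg (block (supp x)ᶜ (supp x)ᶜ Sig + μ₂ • (1 : Matrix _ _ ℝ))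
    have h2 : 0 ≤ φ / δ * g ^ 2 := by positivity
    linarith
  have hθ : ∀ u : Fin d → ℝ, (∀ i, x i = 0 → u i = 0) → (θ₀ - c) * (u ⬝ᵥ u) ≤ u ⬝ᵥ H *ᵥ u := by
    intro u hu
    have h1 := (abs_le.mp (hdev_op u hu)).1
    rw [Matrix.sub_mulVec, dotProduct_sub] at h1
    have hbs : (block (supp x) (supp x) Sig).IsHermitian := by
      ext i j
      simp only [block, conjTranspose_apply, submatrix_apply, star_trivial]
      exact hSig.apply _ _
    have h2 := lambdaMin_mul_le hbs (sub (supp x) u)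
    have hr : ∀ f : Fin d → ℝ, (∀ i, x i = 0 → f i = 0) → ∑ i : supp x, f i = ∑ i, f i := by
      intro f hf
      rw [Finset.sum_coe_sort (supp x) f, supp, Finset.sum_filter]
      refine Finset.sum_congr rfl fun i _ => ?_
      by_cases h : x i = 0 <;> simp [h, hf]
    have h3 : sub (supp x) u ⬝ᵥ sub (supp x) u = u ⬝ᵥ u :=
      hr (fun i => u i * u i) fun i hi => by simp [hu i hi]
    have h4 : sub (supp x) u ⬝ᵥ block (supp x) (supp x) Sig *ᵥ sub (supp x) u = u ⬝ᵥ Sig *ᵥ u := by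
      rw [dotProduct_mulVec_eq_sum, dotProduct_mulVec_eq_sum]
      simp only [sub, block, submatrix_apply]
      rw [← hr (fun i => ∑ j, u i * Sig i j * u j) fun i hi => by simp [hu i hi]]
      refine Finset.sum_congr rfl fun i _ => ?_
      exact hr (fun j => u i * Sig i j * u j) fun j hj => by simp [hu j hj]
    rw [h3, h4] at h2
    nlinarith
  -- Of the slack `β` in D3, half pays for the sampling error of the entries of `H` and half for the
  -- term `τ` that makes the lower block strictly positive.
  refine recovers_of_bounds (θ := θ₀ - c) (τ := β / 2) (φ := φ) (Y := Y) (μ₂ := μ₂) (μ₃ := μ₃)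
    hx hσ hσ0 hH hy hδ (by linarith) hμ0 (by rw [hYdef, neg_neg]) hY ?_ hθ (by linarith) ?_ ?_ ?_
  · have h1 : fFun σ x (sub (supp x) y) ^ 2 ≤ φ :=
      pow_le_pow_left₀ (Real.sqrt_nonneg _) hfle 2
    have h2 : (∑ i ∈ supp x, y i ^ 2) / Y ^ 2 - 1 / (σ : ℝ)
        ≤ fFun σ x (sub (supp x) y) ^ 2 := by
      have h3 : l2norm (sub (supp x) y) ^ 2 = ∑ i ∈ supp x, y i ^ 2 := by
        rw [l2norm_sq]
        simp only [dotProduct, sub, ← sq]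
        exact Finset.sum_coe_sort (supp x) (fun i => y i ^ 2)
      rw [fFun, hsum, h3, hYdef, neg_sq]
      by_cases hs : 0 ≤ (∑ i ∈ supp x, y i ^ 2) / (y ⬝ᵥ x) ^ 2 - 1 / (σ : ℝ)
      · rw [Real.sq_sqrt hs]
      · exact (le_of_not_ge hs).trans (sq_nonneg _)
    exact h2.trans h1
  · intro i hi
    have hmin := ciInf_le (f := fun i : supp x => (-(sub (supp x) yh)
        - block (supp x) (supp x) Sig *ᵥ sub (supp x) x) i / x i)
      (Set.finite_range _).bddBelow ⟨i, hmem i hi⟩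
    have h1 : (block (supp x) (supp x) Sig *ᵥ sub (supp x) x) ⟨i, hmem i hi⟩ = (Sig *ᵥ x) i := by
      simp only [mulVec]
      exact hsum (fun j => Sig i j)
    simp only [Pi.sub_apply, Pi.neg_apply, h1, sub] at hmin
    have h2 : (σ : ℝ) * μ₃ = θ₀ - δ + (⨅ i : supp x, (-(sub (supp x) yh)
        - block (supp x) (supp x) Sig *ᵥ sub (supp x) x) i / x i)
        - lam - B₁ * L ^ 2 * √(σ * Real.log d / n) - c := by
      rw [hμ₃, muHat3, ← mul_assoc, mul_one_div_cancel hσ'.ne', one_mul]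
    simp only [Pi.sub_apply, Pi.neg_apply, sub] at h2
    have h3 := hdev_x i
    have h4 := hdev_y i
    rw [Matrix.sub_mulVec, Pi.sub_apply] at h3
    have h5 : (-yh i - (Sig *ᵥ x) i) / x i - lam / 3 - B₁ * L ^ 2 * √(σ * Real.log d / n)
        ≤ (-(y i) - (H *ᵥ x) i) / x i := by
      have h6 : (-yh i - (Sig *ᵥ x) i) / x i - (-(y i) - (H *ᵥ x) i) / x i
          = ((y i - yh i) + ((H *ᵥ x) i - (Sig *ᵥ x) i)) / x i := by field_simp; ring
      have h7 : |((y i - yh i) + ((H *ᵥ x) i - (Sig *ᵥ x) i)) / x i|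
          ≤ lam / 3 + B₁ * L ^ 2 * √(σ * Real.log d / n) := by
        rw [abs_div, hx.abs_eq, hx.mul_self hi, div_one]
        exact (abs_add_le _ _).trans (add_le_add h4 h3)
      linarith [(abs_le.mp h7).2]
    linarith
  · intro i j hi hj
    have h1 := le_maxNorm (block (supp x) (supp x)ᶜ Sig
      + (1 / (σ : ℝ)) • Matrix.vecMulVec (sub (supp x) x) (sub (supp x)ᶜ yh))
      ⟨i, hmem i hi⟩ ⟨j, hmemc j hj⟩
    simp only [Matrix.add_apply, Matrix.smul_apply, vecMulVec_apply, block, submatrix_apply, sub,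
      smul_eq_mul] at h1
    have h2 : |H i j - Sig i j| ≤ β / 2 := hdev_entry i j
    have h3 : |1 / (σ : ℝ) * (x i * (y j - yh j))| ≤ 1 / (σ : ℝ) * (lam / 3) := by
      rw [abs_mul, abs_mul, hx.abs_eq, hx.mul_self hi, one_mul, abs_of_pos (by positivity)]
      exact mul_le_mul_of_nonneg_left (hdev_y j) (by positivity)
    have h4 : H i j + 1 / (σ : ℝ) * (x i * y j) = (Sig i j + 1 / (σ : ℝ) * (x i * yh j))
        + (H i j - Sig i j) + 1 / (σ : ℝ) * (x i * (y j - yh j)) := by ring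
    have h5 := abs_add_three (Sig i j + 1 / (σ : ℝ) * (x i * yh j)) (H i j - Sig i j)
      (1 / (σ : ℝ) * (x i * (y j - yh j)))
    rw [h4]
    have h6 : 1 / (σ : ℝ) * (lam / 3) ≤ 1 / (σ : ℝ) * lam :=
      mul_le_mul_of_nonneg_left (by linarith) (by positivity)
    unfold CondD2 at hD2
    simp only [block] at hD2
    linarith
  · intro i j hi hj
    have h1 := le_maxNorm (block (supp x)ᶜ (supp x)ᶜ Sig + μ₂ • (1 : Matrix _ _ ℝ))
      ⟨i, hmemc i hi⟩ ⟨j, hmemc j hj⟩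
    simp only [Matrix.add_apply, Matrix.smul_apply, block, submatrix_apply, smul_eq_mul,
      Matrix.one_apply, Subtype.mk.injEq, mul_ite, mul_one, mul_zero] at h1
    have h2 : |H i j - Sig i j| ≤ β / 2 := hdev_entry i j
    have h3 : |(1 / Y + φ / δ) * (y i * y j)| ≤ g ^ 2 / (Yh - σ * lam) + φ / δ * g ^ 2 := by
      rw [abs_mul, abs_mul, abs_of_nonneg (by positivity)]
      have h4 : |y i| * |y j| ≤ g ^ 2 := by
        rw [sq]; exact mul_le_mul (hyg i hi) (hyg j hj) (abs_nonneg _) hg0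
      have h5 : 1 / Y ≤ 1 / (Yh - σ * lam) := one_div_le_one_div_of_le hYh' hYge
      calc (1 / Y + φ / δ) * (|y i| * |y j|)
          ≤ (1 / (Yh - σ * lam) + φ / δ) * g ^ 2 := by gcongr
        _ = _ := by ring
    have h4 : |if i = j then β / 2 else 0| ≤ β / 2 := by
      split_ifs
      · rw [abs_of_pos (by linarith)]
      · rw [abs_zero]; linarith
    have h5 : ∀ a b c d : ℝ, |a + b - c - d| ≤ |a| + |b| + |c| + |d| := by
      intro a b c d
      exact (abs_sub _ _).trans (add_le_add ((abs_sub _ _).trans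
        (add_le_add (abs_add_le _ _) le_rfl)) le_rfl)
    have h6 := h5 (Sig i j + if i = j then μ₂ else 0) (H i j - Sig i j)
      ((1 / Y + φ / δ) * (y i * y j)) (if i = j then β / 2 else 0)
    have h7 : H i j + (if i = j then μ₂ else 0) - (1 / Y + φ / δ) * (y i * y j)
        - (if i = j then β / 2 else 0)
        = (Sig i j + if i = j then μ₂ else 0) + (H i j - Sig i j)
          - (1 / Y + φ / δ) * (y i * y j) - (if i = j then β / 2 else 0) := by ring
    rw [h7]
    simp only [block] at hD3
    linarith

/-! ### Exponential moments and a Bernstein inequality for products -/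

section Scalar

/-- Gaussian linearisation: it writes the exponential of a square as an average of exponentials of
linear terms, to which the sub-Gaussian bound applies. -/
lemma integral_exp_mul_sub_sq (x : ℝ) :
    ∫ t : ℝ, Real.exp (t * x - t ^ 2) = √Real.pi * Real.exp (x ^ 2 / 4) := by
  have h : ∀ t : ℝ, Real.exp (t * x - t ^ 2)
      = Real.exp (x ^ 2 / 4) * (fun u : ℝ => Real.exp (-1 * u ^ 2)) (t - x / 2) := by
    intro t; simp only; rw [← Real.exp_add]; ring_nf
  simp_rw [h]
  rw [integral_const_mul, integral_sub_right_eq_self (fun u : ℝ => Real.exp (-1 * u ^ 2)),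
    integral_gaussian, div_one, mul_comm]

lemma integrable_exp_mul_sub_sq (x : ℝ) :
    Integrable fun t : ℝ => Real.exp (t * x - t ^ 2) := by
  have h : ∀ t : ℝ, Real.exp (t * x - t ^ 2)
      = Real.exp (x ^ 2 / 4) * (fun u : ℝ => Real.exp (-1 * u ^ 2)) (t - x / 2) := by
    intro t; simp only; rw [← Real.exp_add]; ring_nf
  simp_rw [h]
  exact ((integrable_exp_neg_mul_sq one_pos).comp_sub_right (x / 2)).const_mul _

/-- A Taylor bound valid on the whole line; in expectation the linear term disappears for centered
variables, leaving a bound of order `t²`. -/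
lemma exp_le_one_add_add (x : ℝ) : Real.exp x ≤ 1 + x + x ^ 2 * Real.exp |x| := by
  have he : 1 ≤ Real.exp |x| := Real.one_le_exp (abs_nonneg x)
  have hx2 : x ^ 2 ≤ x ^ 2 * Real.exp |x| := le_mul_of_one_le_right (sq_nonneg x) he
  rcases le_or_gt |x| 1 with h | h
  · have := (abs_le.mp (Real.abs_exp_sub_one_sub_id_le h)).2
    linarith
  · rcases lt_abs.mp h with h1 | h1
    · rw [abs_of_pos (by linarith)]
      nlinarith [mul_nonneg (by nlinarith : 0 ≤ x ^ 2 - 1) (Real.exp_pos x).le]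
    · have : Real.exp x ≤ 1 := Real.exp_le_one_iff.mpr (by linarith)
      nlinarith

lemma sq_le_two_mul_exp {y : ℝ} (hy : 0 ≤ y) : y ^ 2 ≤ 2 * Real.exp y := by
  have := Real.quadratic_le_exp_of_nonneg hy
  nlinarith

end Scalar

variable {Ω : Type*} [MeasurableSpace Ω] {P : Measure Ω}

/-- The exponential moment of the square of a sub-Gaussian variable. -/
lemma HasSubgaussianMGF.lintegral_exp_sq_le {X : Ω → ℝ} (hm : Measurable X) [SFinite P]
    (h : HasSubgaussianMGF X 1 P) :
    ∫⁻ ω, ENNReal.ofReal (Real.exp (X ω ^ 2 / 4)) ∂P ≤ ENNReal.ofReal √2 := by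
  have h1 : ∀ ω, ENNReal.ofReal √Real.pi * ENNReal.ofReal (Real.exp (X ω ^ 2 / 4))
      = ∫⁻ t : ℝ, ENNReal.ofReal (Real.exp (t * X ω - t ^ 2)) := by
    intro ω
    rw [← ENNReal.ofReal_mul (Real.sqrt_nonneg _), ← integral_exp_mul_sub_sq,
      ofReal_integral_eq_lintegral_ofReal (integrable_exp_mul_sub_sq _)
        (ae_of_all _ fun t => (Real.exp_pos _).le)]
  -- The moment bound `e^(t²/2)` meets the weight `e^(-t²)`. Integrating over `t` gives `√(2π)`,
  -- hence `√2` after division by `√π`.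
  have h2 : ∀ t : ℝ, ∫⁻ ω, ENNReal.ofReal (Real.exp (t * X ω - t ^ 2)) ∂P
      ≤ ENNReal.ofReal (Real.exp (-(1 / 2) * t ^ 2)) := by
    intro t
    have h3 : ∀ ω, Real.exp (t * X ω - t ^ 2) = Real.exp (-t ^ 2) * Real.exp (t * X ω) := by
      intro ω; rw [← Real.exp_add]; ring_nf
    simp_rw [h3]
    rw [← ofReal_integral_eq_lintegral_ofReal ((h.integrable_exp_mul t).const_mul _)
      (ae_of_all _ fun _ => by positivity), integral_const_mul]
    refine ENNReal.ofReal_le_ofReal ?_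
    have h4 : ∫ ω, Real.exp (t * X ω) ∂P ≤ _ := h.mgf_le t
    calc Real.exp (-t ^ 2) * ∫ ω, Real.exp (t * X ω) ∂P
        ≤ Real.exp (-t ^ 2) * Real.exp ((1 : ℝ≥0) * t ^ 2 / 2) := by gcongr
      _ = _ := by rw [← Real.exp_add]; push_cast; ring_nf
  have h5 : ENNReal.ofReal √Real.pi * ∫⁻ ω, ENNReal.ofReal (Real.exp (X ω ^ 2 / 4)) ∂P
      ≤ ENNReal.ofReal √Real.pi * ENNReal.ofReal √2 := by
    calc _ = ∫⁻ ω, (∫⁻ t : ℝ, ENNReal.ofReal (Real.exp (t * X ω - t ^ 2))) ∂P := by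
          rw [← lintegral_const_mul' _ _ ENNReal.ofReal_ne_top]
          exact lintegral_congr h1
      _ = ∫⁻ t : ℝ, (∫⁻ ω, ENNReal.ofReal (Real.exp (t * X ω - t ^ 2)) ∂P) := by
          refine lintegral_lintegral_swap (Measurable.aemeasurable ?_)
          simp only [Function.uncurry_def]
          fun_prop
      _ ≤ ∫⁻ t : ℝ, ENNReal.ofReal (Real.exp (-(1 / 2) * t ^ 2)) := lintegral_mono h2
      _ = ENNReal.ofReal √(Real.pi / (1 / 2)) := by
          rw [← ofReal_integral_eq_lintegral_ofReal (integrable_exp_neg_mul_sq (by norm_num))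
            (ae_of_all _ fun t => (Real.exp_pos _).le), integral_gaussian]
      _ = _ := by
          rw [← ENNReal.ofReal_mul (Real.sqrt_nonneg _), ← Real.sqrt_mul Real.pi_pos.le]
          congr 2; ring
  have hpi : ENNReal.ofReal √Real.pi ≠ 0 := by
    rw [ENNReal.ofReal_ne_zero_iff]; exact Real.sqrt_pos.mpr Real.pi_pos
  exact (ENNReal.mul_le_mul_iff_right hpi ENNReal.ofReal_ne_top).mp h5

lemma HasSubgaussianMGF.integral_exp_sq_le {X : Ω → ℝ} (hm : Measurable X) [SFinite P]
    (h : HasSubgaussianMGF X 1 P) :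
    Integrable (fun ω => Real.exp (X ω ^ 2 / 4)) P
      ∧ ∫ ω, Real.exp (X ω ^ 2 / 4) ∂P ≤ √2 := by
  have h1 := HasSubgaussianMGF.lintegral_exp_sq_le hm h
  have hmeas : Measurable fun ω => Real.exp (X ω ^ 2 / 4) := by fun_prop
  have hpos : ∀ ω, 0 ≤ Real.exp (X ω ^ 2 / 4) := fun _ => (Real.exp_pos _).le
  have hint : Integrable (fun ω => Real.exp (X ω ^ 2 / 4)) P := by
    refine ⟨hmeas.aestronglyMeasurable, ?_⟩
    rw [hasFiniteIntegral_iff_ofReal (ae_of_all _ hpos)]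
    exact h1.trans_lt ENNReal.ofReal_lt_top
  refine ⟨hint, ?_⟩
  rw [← ENNReal.ofReal_le_ofReal_iff (Real.sqrt_nonneg _),
    ofReal_integral_eq_lintegral_ofReal hint (ae_of_all _ hpos)]
  exact h1

/-- A variable with a finite exponential moment is integrable with a bounded mean. -/
lemma abs_integral_le_two [IsProbabilityMeasure P] {Z : Ω → ℝ} (hm : Measurable Z)
    (hint : Integrable (fun ω => Real.exp (|Z ω| / 4)) P)
    (hle : ∫ ω, Real.exp (|Z ω| / 4) ∂P ≤ √2) :
    Integrable Z P ∧ |∫ ω, Z ω ∂P| ≤ 2 := by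
  have hsqrt2 : √2 ≤ 3 / 2 := by
    rw [Real.sqrt_le_left (by norm_num)]; norm_num
  have hZabs : ∀ ω, |Z ω| ≤ 4 * (Real.exp (|Z ω| / 4) - 1) := fun ω => by
    have := Real.add_one_le_exp (|Z ω| / 4)
    linarith
  have hZint : Integrable Z P := by
    refine ((hint.sub (integrable_const 1)).const_mul 4).mono' hm.aestronglyMeasurable
      (ae_of_all _ fun ω => ?_)
    exact hZabs ω
  refine ⟨hZint, ?_⟩
  calc |∫ ω, Z ω ∂P| ≤ ∫ ω, |Z ω| ∂P := abs_integral_le_integral_abs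
    _ ≤ ∫ ω, 4 * (Real.exp (|Z ω| / 4) - 1) ∂P :=
      integral_mono hZint.abs ((hint.sub (integrable_const 1)).const_mul 4) hZabs
    _ = 4 * (∫ ω, Real.exp (|Z ω| / 4) ∂P - 1) := by
      rw [integral_const_mul, integral_sub hint (integrable_const 1)]; simp
    _ ≤ 2 := by linarith

/-- Bernstein-type bound for the moment generating function of a centered variable with a finite
exponential moment. -/
lemma mgf_sub_integral_le [IsProbabilityMeasure P] {Z : Ω → ℝ} (hm : Measurable Z)
    (hint : Integrable (fun ω => Real.exp (|Z ω| / 4)) P)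
    (hle : ∫ ω, Real.exp (|Z ω| / 4) ∂P ≤ √2) {t : ℝ} (ht : |t| ≤ 1 / 16) :
    Integrable (fun ω => Real.exp (t * (Z ω - ∫ ω, Z ω ∂P))) P
      ∧ mgf (fun ω => Z ω - ∫ ω, Z ω ∂P) P t ≤ Real.exp (1024 * t ^ 2) := by
  obtain ⟨hZint, hm2⟩ := abs_integral_le_two hm hint hle
  set m := ∫ ω, Z ω ∂P with hmdef
  have he : Real.exp (1 / 4) ≤ √2 := by
    refine Real.le_sqrt_of_sq_le ?_
    rw [← Real.exp_nat_mul]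
    have h1 : Real.exp ((2 : ℕ) * (1 / 4)) ^ 2 ≤ 2 ^ 2 := by
      rw [← Real.exp_nat_mul]
      have := Real.exp_one_lt_d9
      norm_num; linarith
    exact le_of_sq_le_sq h1 (by norm_num)
  have hW : ∀ ω, |Z ω - m| ≤ |Z ω| + 2 := fun ω => (abs_sub _ _).trans (by linarith)
  -- With `w = Z - m`, the Taylor remainder and the factor `w²` each cost `e^(|w|/16)`. Since `|m| ≤
  -- 2`, their product is at most `e^(1/4 + |Z|/4)`, within the available moment.
  have hpt : ∀ ω, Real.exp (t * (Z ω - m))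
      ≤ 1 + t * (Z ω - m) + t ^ 2 * (512 * (√2 * Real.exp (|Z ω| / 4))) := by
    intro ω
    set w := Z ω - m
    have h1 := exp_le_one_add_add (t * w)
    have h2 : |t * w| ≤ |w| / 16 := by
      rw [abs_mul]; nlinarith [abs_nonneg w]
    have h3 : w ^ 2 ≤ 512 * Real.exp (|w| / 16) := by
      have := sq_le_two_mul_exp (y := |w| / 16) (by positivity)
      rw [div_pow, sq_abs] at this
      linarith
    have h4 : w ^ 2 * Real.exp |t * w| ≤ 512 * (√2 * Real.exp (|Z ω| / 4)) := by
      calc w ^ 2 * Real.exp |t * w| ≤ 512 * Real.exp (|w| / 16) * Real.exp (|w| / 16) := by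
            gcongr
        _ = 512 * Real.exp (|w| / 8) := by
            rw [mul_assoc, ← Real.exp_add]; ring_nf
        _ ≤ 512 * Real.exp (1 / 4 + |Z ω| / 4) := by
            gcongr
            have := hW ω
            have := abs_nonneg (Z ω)
            linarith
        _ ≤ 512 * (√2 * Real.exp (|Z ω| / 4)) := by
            rw [Real.exp_add]; gcongr
    calc Real.exp (t * w) ≤ 1 + t * w + (t * w) ^ 2 * Real.exp |t * w| := h1
      _ = 1 + t * w + t ^ 2 * (w ^ 2 * Real.exp |t * w|) := by ring
      _ ≤ _ := by gcongr
  have hi1 : Integrable (fun ω => t * (Z ω - m)) P :=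
    (hZint.sub (integrable_const m)).const_mul t
  have hi2 : Integrable (fun ω => t ^ 2 * (512 * (√2 * Real.exp (|Z ω| / 4)))) P :=
    ((hint.const_mul _).const_mul _).const_mul _
  have hi3 : Integrable (fun ω => 1 + t * (Z ω - m)) P := (integrable_const 1).add hi1
  have hi : Integrable (fun ω => Real.exp (t * (Z ω - m))) P := by
    refine (hi3.add hi2).mono' (by fun_prop) (ae_of_all _ fun ω => ?_)
    rw [Real.norm_eq_abs, abs_of_pos (Real.exp_pos _)]
    exact hpt ω
  refine ⟨hi, ?_⟩
  calc mgf (fun ω => Z ω - m) P t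
      ≤ ∫ ω, (1 + t * (Z ω - m) + t ^ 2 * (512 * (√2 * Real.exp (|Z ω| / 4)))) ∂P :=
        integral_mono hi (hi3.add hi2) hpt
    _ = 1 + t ^ 2 * (512 * (√2 * ∫ ω, Real.exp (|Z ω| / 4) ∂P)) := by
        rw [integral_add hi3 hi2, integral_add (integrable_const 1) hi1]
        simp only [integral_const_mul]
        rw [integral_sub hZint (integrable_const m)]
        simp [hmdef]
    _ ≤ 1 + t ^ 2 * (512 * (√2 * √2)) := by gcongr
    _ = 1024 * t ^ 2 + 1 := by rw [Real.mul_self_sqrt (by norm_num)]; ring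
    _ ≤ Real.exp (1024 * t ^ 2) := Real.add_one_le_exp _

/-- Products of normalized sub-Gaussian variables have a finite exponential moment. -/
lemma integral_exp_abs_mul_le [SFinite P] {X Y : Ω → ℝ} (hXm : Measurable X) (hYm : Measurable Y)
    (hX : HasSubgaussianMGF X 1 P) (hY : HasSubgaussianMGF Y 1 P) :
    Integrable (fun ω => Real.exp (|X ω * Y ω| / 4)) P
      ∧ ∫ ω, Real.exp (|X ω * Y ω| / 4) ∂P ≤ √2 := by
  obtain ⟨hX1, hX2⟩ := HasSubgaussianMGF.integral_exp_sq_le hXm hX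
  obtain ⟨hY1, hY2⟩ := HasSubgaussianMGF.integral_exp_sq_le hYm hY
  have hpt : ∀ ω, Real.exp (|X ω * Y ω| / 4)
      ≤ (1 / 2) * (Real.exp (X ω ^ 2 / 4) + Real.exp (Y ω ^ 2 / 4)) := by
    intro ω
    have h1 : |X ω * Y ω| / 4 ≤ X ω ^ 2 / 8 + Y ω ^ 2 / 8 := by
      rw [abs_mul, ← sq_abs (X ω), ← sq_abs (Y ω)]
      nlinarith [sq_nonneg (|X ω| - |Y ω|)]
    have h2 : Real.exp (X ω ^ 2 / 4) = Real.exp (X ω ^ 2 / 8) ^ 2 := by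
      rw [← Real.exp_nat_mul]; push_cast; ring_nf
    have h3 : Real.exp (Y ω ^ 2 / 4) = Real.exp (Y ω ^ 2 / 8) ^ 2 := by
      rw [← Real.exp_nat_mul]; push_cast; ring_nf
    calc Real.exp (|X ω * Y ω| / 4) ≤ Real.exp (X ω ^ 2 / 8 + Y ω ^ 2 / 8) := by gcongr
      _ = Real.exp (X ω ^ 2 / 8) * Real.exp (Y ω ^ 2 / 8) := Real.exp_add _ _
      _ ≤ _ := by
        rw [h2, h3]
        nlinarith [sq_nonneg (Real.exp (X ω ^ 2 / 8) - Real.exp (Y ω ^ 2 / 8))]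
  have hi := (hX1.add hY1).const_mul (1 / 2)
  have hi' : Integrable (fun ω => Real.exp (|X ω * Y ω| / 4)) P := by
    refine hi.mono' ?_ (ae_of_all _ fun ω => ?_)
    · have : Measurable fun ω => |X ω * Y ω| := (hXm.mul hYm).abs
      exact (Real.measurable_exp.comp (this.div_const 4)).aestronglyMeasurable
    · rw [Real.norm_eq_abs, abs_of_pos (Real.exp_pos _)]
      exact hpt ω
  refine ⟨hi', (integral_mono hi' hi hpt).trans ?_⟩
  simp only [Pi.add_apply]
  rw [integral_const_mul, integral_add hX1 hY1]
  linarith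

/-- Chernoff bound for averages of products of normalized sub-Gaussian variables. -/
lemma measure_abs_sum_mul_sub_ge_le_of_normalized {n : ℕ} {X Y : Fin n → Ω → ℝ}
    (hXm : ∀ k, Measurable (X k)) (hYm : ∀ k, Measurable (Y k))
    (hX : ∀ k, HasSubgaussianMGF (X k) 1 P) (hY : ∀ k, HasSubgaussianMGF (Y k) 1 P)
    (hind : iIndepFun (fun k ω => X k ω * Y k ω) P) {m : ℝ}
    (hmean : ∀ k, ∫ ω, X k ω * Y k ω ∂P = m) {s : ℝ} (hs0 : 0 ≤ s) (hs1 : s ≤ 1) :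
    P.real {ω | n * (80 * s) ≤ |∑ k, (X k ω * Y k ω - m)|} ≤ 2 * Real.exp (-(n * s ^ 2)) := by
  have hP : IsProbabilityMeasure P := hind.isProbabilityMeasure
  have hmgf : ∀ t : ℝ, |t| ≤ 1 / 16 → ∀ k,
      Integrable (fun ω => Real.exp (t * (X k ω * Y k ω - m))) P
      ∧ mgf (fun ω => X k ω * Y k ω - m) P t ≤ Real.exp (1024 * t ^ 2) := by
    intro t ht k
    obtain ⟨h1, h2⟩ := integral_exp_abs_mul_le (hXm k) (hYm k) (hX k) (hY k)
    have := mgf_sub_integral_le ((hXm k).mul (hYm k)) h1 h2 ht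
    simpa only [Pi.mul_apply, hmean k] using this
  have hmeas : ∀ k, Measurable fun ω => X k ω * Y k ω - m :=
    fun k => ((hXm k).mul (hYm k)).sub_const m
  have hind' : iIndepFun (fun k ω => X k ω * Y k ω - m) P :=
    hind.comp (fun _ u => u - m) fun _ => measurable_id.sub_const m
  have hsumfun : (fun ω => ∑ k, (X k ω * Y k ω - m)) = ∑ k, fun ω => X k ω * Y k ω - m := by
    ext ω; simp
  have hint : ∀ t : ℝ, |t| ≤ 1 / 16 →
      Integrable (fun ω => Real.exp (t * ∑ k, (X k ω * Y k ω - m))) P := by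
    intro t ht
    have := hind'.integrable_exp_mul_sum (t := t) hmeas (s := Finset.univ)
      (fun k _ => (hmgf t ht k).1)
    rw [← hsumfun] at this
    exact this
  have hmgfsum : ∀ t : ℝ, |t| ≤ 1 / 16 →
      mgf (fun ω => ∑ k, (X k ω * Y k ω - m)) P t ≤ Real.exp (n * (1024 * t ^ 2)) := by
    intro t ht
    rw [hsumfun, hind'.mgf_sum hmeas]
    calc ∏ k, mgf (fun ω => X k ω * Y k ω - m) P t
        ≤ ∏ _k : Fin n, Real.exp (1024 * t ^ 2) :=
          Finset.prod_le_prod (fun _ _ => mgf_nonneg) fun k _ => (hmgf t ht k).2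
      _ = _ := by rw [Finset.prod_const, Finset.card_univ, Fintype.card_fin, ← Real.exp_nat_mul]
  have ht : |s / 16| ≤ 1 / 16 := by rw [abs_of_nonneg (by positivity)]; linarith
  have ht' : |-(s / 16)| ≤ 1 / 16 := by rwa [abs_neg]
  -- At the parameter `s / 16`, admissible since `s ≤ 1`, the exponent is `-5ns² + 4ns²`.
  have hup : P.real {ω | n * (80 * s) ≤ ∑ k, (X k ω * Y k ω - m)} ≤ Real.exp (-(n * s ^ 2)) := by
    refine (measure_ge_le_exp_mul_mgf _ (by positivity : 0 ≤ s / 16) (hint _ ht)).trans ?_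
    calc _ ≤ Real.exp (-(s / 16) * (n * (80 * s))) * Real.exp (n * (1024 * (s / 16) ^ 2)) := by
          gcongr; exact hmgfsum _ ht
      _ = _ := by rw [← Real.exp_add]; ring_nf
  have hlow : P.real {ω | ∑ k, (X k ω * Y k ω - m) ≤ -(n * (80 * s))}
      ≤ Real.exp (-(n * s ^ 2)) := by
    refine (measure_le_le_exp_mul_mgf _ (by linarith : -(s / 16) ≤ 0) (hint _ ht')).trans ?_
    calc _ ≤ Real.exp (-(-(s / 16)) * -(n * (80 * s)))
            * Real.exp (n * (1024 * (-(s / 16)) ^ 2)) := by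
          gcongr; exact hmgfsum _ ht'
      _ = _ := by rw [← Real.exp_add]; ring_nf
  have hsub : {ω | n * (80 * s) ≤ |∑ k, (X k ω * Y k ω - m)|}
      ⊆ {ω | n * (80 * s) ≤ ∑ k, (X k ω * Y k ω - m)}
        ∪ {ω | ∑ k, (X k ω * Y k ω - m) ≤ -(n * (80 * s))} := by
    intro ω hω
    rcases le_abs.mp (show _ ≤ |∑ k, (X k ω * Y k ω - m)| from hω) with h | h
    · exact Or.inl h
    · exact Or.inr (show ∑ k, (X k ω * Y k ω - m) ≤ -(n * (80 * s)) by linarith)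
  calc _ ≤ _ := measureReal_mono hsub
    _ ≤ _ := measureReal_union_le _ _
    _ ≤ _ := by linarith

lemma hasSubgaussianMGF_inv_mul {X : Ω → ℝ} {a : ℝ≥0} (ha : 0 < a)
    (hX : HasSubgaussianMGF X (a ^ 2) P) : HasSubgaussianMGF (fun ω => (a : ℝ)⁻¹ * X ω) 1 P := by
  have := hX.const_mul (a : ℝ)⁻¹
  convert this using 1
  ext
  push_cast
  have : (a : ℝ) ≠ 0 := by exact_mod_cast ha.ne'
  show (1 : ℝ) = (a : ℝ)⁻¹ ^ 2 * (a : ℝ) ^ 2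
  field_simp

lemma abs_integral_mul_le [IsProbabilityMeasure P] {X Y : Ω → ℝ} {a b : ℝ≥0}
    (ha : 0 < a) (hb : 0 < b) (hXm : Measurable X) (hYm : Measurable Y)
    (hX : HasSubgaussianMGF X (a ^ 2) P) (hY : HasSubgaussianMGF Y (b ^ 2) P) :
    |∫ ω, X ω * Y ω ∂P| ≤ 2 * (a * b) := by
  have ha' : (0 : ℝ) < a := ha
  have hb' : (0 : ℝ) < b := hb
  obtain ⟨h1, h2⟩ := integral_exp_abs_mul_le (hXm.const_mul (a : ℝ)⁻¹) (hYm.const_mul (b : ℝ)⁻¹)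
    (hasSubgaussianMGF_inv_mul ha hX) (hasSubgaussianMGF_inv_mul hb hY)
  have h3 := (abs_integral_le_two ((hXm.const_mul (a : ℝ)⁻¹).mul (hYm.const_mul (b : ℝ)⁻¹))
    h1 h2).2
  have hprod : ∀ ω, ((a : ℝ)⁻¹ * X ω) * ((b : ℝ)⁻¹ * Y ω)
      = ((a : ℝ)⁻¹ * (b : ℝ)⁻¹) * (X ω * Y ω) := fun ω => by ring
  simp only [Pi.mul_apply, hprod, integral_const_mul] at h3
  rw [abs_mul, abs_of_pos (by positivity : 0 < (a : ℝ)⁻¹ * (b : ℝ)⁻¹), ← mul_inv, inv_mul_eq_div,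
    div_le_iff₀ (by positivity)] at h3
  exact h3

/-- Concentration of averages of products of sub-Gaussian variables. -/
theorem measure_abs_average_mul_sub_ge_le {n : ℕ} (hn : 0 < n) {X Y : Fin n → Ω → ℝ} {a b : ℝ≥0}
    (ha : 0 < a) (hb : 0 < b) (hXm : ∀ k, Measurable (X k)) (hYm : ∀ k, Measurable (Y k))
    (hX : ∀ k, HasSubgaussianMGF (X k) (a ^ 2) P) (hY : ∀ k, HasSubgaussianMGF (Y k) (b ^ 2) P)
    (hind : iIndepFun (fun k ω => X k ω * Y k ω) P) {m : ℝ}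
    (hmean : ∀ k, ∫ ω, X k ω * Y k ω ∂P = m) {s : ℝ} (hs0 : 0 ≤ s) (hs1 : s ≤ 1) :
    P.real {ω | 80 * (a * b) * s ≤ |1 / (n : ℝ) * ∑ k, X k ω * Y k ω - m|}
      ≤ 2 * Real.exp (-(n * s ^ 2)) := by
  have ha' : (0 : ℝ) < a := ha
  have hb' : (0 : ℝ) < b := hb
  have hn' : (0 : ℝ) < n := by exact_mod_cast hn
  have hprod : ∀ k ω, ((a : ℝ)⁻¹ * X k ω) * ((b : ℝ)⁻¹ * Y k ω)
      = ((a : ℝ)⁻¹ * (b : ℝ)⁻¹) * (X k ω * Y k ω) := fun k ω => by ring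
  have key := measure_abs_sum_mul_sub_ge_le_of_normalized (P := P) (s := s)
    (m := ((a : ℝ)⁻¹ * (b : ℝ)⁻¹) * m)
    (X := fun k ω => (a : ℝ)⁻¹ * X k ω) (Y := fun k ω => (b : ℝ)⁻¹ * Y k ω)
    (fun k => (hXm k).const_mul _) (fun k => (hYm k).const_mul _)
    (fun k => hasSubgaussianMGF_inv_mul ha (hX k)) (fun k => hasSubgaussianMGF_inv_mul hb (hY k))
    (by
      simp only [hprod]
      exact hind.comp (fun _ u => ((a : ℝ)⁻¹ * (b : ℝ)⁻¹) * u) fun _ => measurable_const_mul _)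
    (fun k => by simp only [hprod]; rw [integral_const_mul, hmean]) hs0 hs1
  refine le_trans (le_of_eq ?_) key
  congr 1
  ext ω
  simp only [Set.mem_ofPred_eq, hprod, ← mul_sub, ← Finset.mul_sum]
  have h1 : 1 / (n : ℝ) * ∑ k, X k ω * Y k ω - m = 1 / (n : ℝ) * ∑ k, (X k ω * Y k ω - m) := by
    rw [Finset.sum_sub_distrib]; simp; field_simp
  rw [h1, abs_mul, abs_mul, abs_of_pos (by positivity : 0 < 1 / (n : ℝ)),
    abs_of_pos (by positivity : 0 < (a : ℝ)⁻¹ * (b : ℝ)⁻¹)]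
  rw [one_div, inv_mul_eq_div, le_div_iff₀ hn', ← mul_inv, inv_mul_eq_div,
    le_div_iff₀ (by positivity)]
  constructor <;> intro h <;> linarith

/-! ### Half-nets and the operator norm -/

section Net

/-- The unit ball of a Euclidean space has a `1/2`-net with at most `5 ^ dim` points. -/
lemma exists_half_net (E : Type*) [NormedAddCommGroup E] [NormedSpace ℝ E]
    [FiniteDimensional ℝ E] :
    ∃ N : Finset E, N.card ≤ 5 ^ Module.finrank ℝ E ∧ (∀ v ∈ N, ‖v‖ ≤ 1) ∧
      ∀ u : E, ‖u‖ ≤ 1 → ∃ v ∈ N, ‖u - v‖ ≤ 1 / 2 := by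
  classical
  by_contra hcon
  push Not at hcon
  -- If small nets did not exist, a 1-separated set in the ball of radius 2, scaled by one half,
  -- could never be a net. A missed point, scaled back, extends the set, and this would go on past
  -- the packing bound.
  have hind : ∀ k : ℕ, ∃ s : Finset E, s.card = k ∧ (∀ c ∈ s, ‖c‖ ≤ 2) ∧
      ∀ c ∈ s, ∀ e ∈ s, c ≠ e → 1 ≤ ‖c - e‖ := by
    intro k
    induction k with
    | zero => exact ⟨∅, by simp⟩
    | succ k ih =>
      obtain ⟨s, hsk, hs2, hsep⟩ := ih
      have hcard : (s.image fun c => (1 / 2 : ℝ) • c).card ≤ 5 ^ Module.finrank ℝ E :=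
        Finset.card_image_le.trans (Besicovitch.card_le_of_separated s hs2 hsep)
      obtain ⟨u, hu, hu'⟩ := hcon _ hcard (by
        intro v hv
        obtain ⟨c, hc, rfl⟩ := Finset.mem_image.mp hv
        rw [norm_smul, Real.norm_eq_abs, abs_of_pos (by norm_num)]
        linarith [hs2 c hc])
      have hfar : ∀ c ∈ s, 1 ≤ ‖(2 : ℝ) • u - c‖ := by
        intro c hc
        have h1 := hu' _ (Finset.mem_image_of_mem _ hc)
        have h2 : (2 : ℝ) • u - c = (2 : ℝ) • (u - (1 / 2 : ℝ) • c) := by module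
        rw [h2, norm_smul, Real.norm_eq_abs, abs_of_pos (by norm_num)]
        linarith
      have hnot : (2 : ℝ) • u ∉ s := fun hmem => by
        have := hfar _ hmem
        rw [sub_self, norm_zero] at this
        linarith
      refine ⟨insert ((2 : ℝ) • u) s, by rw [Finset.card_insert_of_notMem hnot, hsk], ?_, ?_⟩
      · intro c hc
        rcases Finset.mem_insert.mp hc with rfl | hc
        · rw [norm_smul, Real.norm_eq_abs, abs_of_pos (by norm_num)]; linarith
        · exact hs2 c hc
      · intro c hc e he hne
        rcases Finset.mem_insert.mp hc with rfl | hc <;> rcases Finset.mem_insert.mp he with rfl | he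
        · exact absurd rfl hne
        · exact hfar e he
        · rw [norm_sub_rev]; exact hfar c hc
        · exact hsep c hc e he hne
  obtain ⟨s, hsk, hs2, hsep⟩ := hind (5 ^ Module.finrank ℝ E + 1)
  have := Besicovitch.card_le_of_separated s hs2 hsep
  omega

/-- The operator norm is controlled by a bilinear form on a `1/2`-net. -/
lemma opNorm_le_of_half_net {E : Type*} [NormedAddCommGroup E] [InnerProductSpace ℝ E]
    {N : Finset E} (hnet : ∀ u : E, ‖u‖ ≤ 1 → ∃ v ∈ N, ‖u - v‖ ≤ 1 / 2) (A : E →L[ℝ] E) {m : ℝ}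
    (hm : ∀ u ∈ N, ∀ v ∈ N, |inner ℝ u (A v)| ≤ m) : ‖A‖ ≤ 4 * m := by
  have hnet' : ∀ u : E, u ≠ 0 → ∃ v ∈ N, ‖u - ‖u‖ • v‖ ≤ ‖u‖ / 2 := by
    intro u hu
    have hu' : 0 < ‖u‖ := norm_pos_iff.mpr hu
    obtain ⟨v, hv, h⟩ := hnet (‖u‖⁻¹ • u) (by
      rw [norm_smul, norm_inv, norm_norm, inv_mul_cancel₀ hu'.ne'])
    refine ⟨v, hv, ?_⟩
    have h2 : u - ‖u‖ • v = ‖u‖ • (‖u‖⁻¹ • u - v) := by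
      rw [smul_sub, smul_smul, mul_inv_cancel₀ hu'.ne', one_smul]
    rw [h2, norm_smul, norm_norm]
    nlinarith
  have hm0 : 0 ≤ m := by
    obtain ⟨v, hv, -⟩ := hnet 0 (by simp)
    exact (abs_nonneg _).trans (hm v hv v hv)
  -- Approximating the left vector by the net costs a factor `2`; approximating the right one in
  -- `hle` costs another.
  have hnorm : ∀ v ∈ N, ‖A v‖ ≤ 2 * m := by
    intro v hv
    by_cases h0 : A v = 0
    · rw [h0, norm_zero]; linarith
    have hpos : 0 < ‖A v‖ := norm_pos_iff.mpr h0
    obtain ⟨u, hu, h⟩ := hnet' _ h0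
    have h1 : ‖A v‖ * ‖A v‖ = inner ℝ (A v - ‖A v‖ • u) (A v) + ‖A v‖ * inner ℝ u (A v) := by
      rw [inner_sub_left, real_inner_smul_left, real_inner_self_eq_norm_mul_norm]; ring
    have h2 : inner ℝ (A v - ‖A v‖ • u) (A v) ≤ ‖A v‖ / 2 * ‖A v‖ :=
      (real_inner_le_norm _ _).trans (by gcongr)
    have h3 := (le_abs_self _).trans (hm u hu v hv)
    have h4 : ‖A v‖ * ‖A v‖ ≤ ‖A v‖ * (‖A v‖ / 2 + m) := by nlinarith
    have := le_of_mul_le_mul_left h4 hpos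
    linarith
  have hle : ‖A‖ ≤ 2 * m + ‖A‖ / 2 := by
    refine A.opNorm_le_bound (by positivity) fun u => ?_
    by_cases h0 : u = 0
    · simp [h0]
    obtain ⟨v, hv, h⟩ := hnet' u h0
    have h1 : A u = A (u - ‖u‖ • v) + ‖u‖ • A v := by
      rw [map_sub, map_smul, sub_add_cancel]
    calc ‖A u‖ ≤ ‖A (u - ‖u‖ • v)‖ + ‖‖u‖ • A v‖ := by
          conv_lhs => rw [h1]
          exact norm_add_le _ _
      _ ≤ ‖A‖ * (‖u‖ / 2) + ‖u‖ * (2 * m) := by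
          refine add_le_add ((A.le_opNorm _).trans (by gcongr)) ?_
          rw [norm_smul, norm_norm]
          exact mul_le_mul_of_nonneg_left (hnorm v hv) (norm_nonneg _)
      _ = _ := by ring
  linarith

end Net

/-! ### Pairing independent families -/

section JointIndependence

/-- Two independent families of independent variables can be paired. -/
lemma iIndepFun_prodMk_of_indepFun {ι : Type*} [Fintype ι] {β γ : Type*} [MeasurableSpace β]
    [MeasurableSpace γ] {X : ι → Ω → β} {Y : ι → Ω → γ} (hXm : ∀ i, Measurable (X i))
    (hYm : ∀ i, Measurable (Y i)) (hX : iIndepFun X P) (hY : iIndepFun Y P)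
    (hXY : IndepFun (fun ω i => X i ω) (fun ω i => Y i ω) P) :
    iIndepFun (fun i ω => (X i ω, Y i ω)) P := by
  classical
  have := hX.isProbabilityMeasure
  have hprob : ∀ i, IsProbabilityMeasure (P.map (X i)) :=
    fun i => Measure.isProbabilityMeasure_map (hXm i).aemeasurable
  have hprob' : ∀ i, IsProbabilityMeasure (P.map (Y i)) :=
    fun i => Measure.isProbabilityMeasure_map (hYm i).aemeasurable
  have hpair : ∀ i, P.map (fun ω => (X i ω, Y i ω)) = (P.map (X i)).prod (P.map (Y i)) := by
    intro i
    refine (indepFun_iff_map_prod_eq_prod_map_map (hXm i).aemeasurable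
      (hYm i).aemeasurable).mp ?_
    exact hXY.comp (measurable_pi_apply i) (measurable_pi_apply i)
  have hXa : Measurable fun ω i => X i ω := measurable_pi_lambda _ hXm
  have hYa : Measurable fun ω i => Y i ω := measurable_pi_lambda _ hYm
  have hjoint := (indepFun_iff_map_prod_eq_prod_map_map hXa.aemeasurable hYa.aemeasurable).mp hXY
  rw [hX.map_fun_eq_pi_map fun i => (hXm i).aemeasurable,
    hY.map_fun_eq_pi_map fun i => (hYm i).aemeasurable] at hjoint
  rw [iIndepFun_iff_map_fun_eq_pi_map fun i => ((hXm i).prodMk (hYm i)).aemeasurable]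
  simp_rw [hpair]
  -- Regrouping a pair of tuples into a tuple of pairs preserves product measures, so the joint law
  -- of the pairs factorises.
  have hmp := measurePreserving_arrowProdEquivProdArrow β γ ι (fun i => P.map (X i))
    (fun i => P.map (Y i))
  have hsymm := hmp.symm.map_eq
  rw [← hsymm, ← hjoint, Measure.map_map (MeasurableEquiv.measurable _) (hXa.prodMk hYa)]
  rfl

end JointIndependence

/-! ### Concentration for sub-Gaussian designs -/

lemma HasSubgaussianMGF.mono {X : Ω → ℝ} {c c' : ℝ≥0} (h : HasSubgaussianMGF X c P)
    (hc : c ≤ c') : HasSubgaussianMGF X c' P := by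
  refine ⟨h.integrable_exp_mul, fun t => (h.mgf_le t).trans ?_⟩
  have : (c : ℝ) ≤ c' := hc
  gcongr

namespace IsSubGaussianDesign

variable {n d : ℕ} {M : Ω → Matrix (Fin n) (Fin d) ℝ} {L : ℝ≥0} {Sig : Matrix (Fin d) (Fin d) ℝ}

lemma measurable_row (hM : IsSubGaussianDesign P M L Sig) (k : Fin n) (u : Fin d → ℝ) :
    Measurable fun ω => M ω k ⬝ᵥ u := by
  simp only [dotProduct]
  exact Finset.measurable_fun_sum _ fun j _ => (hM.measurable k j).mul_const _

/-- Homogeneity extends the assumption from unit vectors to all vectors; the zero vector, which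
cannot be normalised, is treated separately. -/
lemma subgaussian_row [IsProbabilityMeasure P] (hM : IsSubGaussianDesign P M L Sig) (k : Fin n)
    {u : Fin d → ℝ} {a : ℝ≥0} (hu : l2norm u ≤ a) :
    HasSubgaussianMGF (fun ω => M ω k ⬝ᵥ u) ((L * a) ^ 2) P := by
  by_cases h0 : l2norm u = 0
  · rw [l2norm_eq_zero.mp h0]
    simp only [dotProduct_zero]
    exact HasSubgaussianMGF.mono ProbabilityTheory.HasSubgaussianMGF.fun_zero zero_le
  have hpos : 0 < l2norm u := lt_of_le_of_ne (l2norm_nonneg _) (Ne.symm h0)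
  have h1 := hM.subGaussian k ((l2norm u)⁻¹ • u) (by
    rw [l2norm_smul, abs_of_pos (inv_pos.mpr hpos), inv_mul_cancel₀ h0])
  have h2 := h1.const_mul (l2norm u)
  have h3 : (fun ω => l2norm u * ∑ j, M ω k j * ((l2norm u)⁻¹ • u) j) = fun ω => M ω k ⬝ᵥ u := by
    ext ω
    rw [dotProduct, Finset.mul_sum]
    refine Finset.sum_congr rfl fun j _ => ?_
    simp only [Pi.smul_apply, smul_eq_mul]
    field_simp
  rw [h3] at h2
  refine HasSubgaussianMGF.mono h2 ?_
  rw [← NNReal.coe_le_coe]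
  push_cast
  show l2norm u ^ 2 * (L : ℝ) ^ 2 ≤ ((L : ℝ) * a) ^ 2
  rw [mul_pow, mul_comm]
  gcongr

lemma integral_row_mul_row [IsProbabilityMeasure P] (hM : IsSubGaussianDesign P M L Sig)
    (k : Fin n) (u v : Fin d → ℝ) :
    ∫ ω, (M ω k ⬝ᵥ u) * (M ω k ⬝ᵥ v) ∂P = u ⬝ᵥ Sig *ᵥ v := by
  have hLp : ∀ j, MemLp (fun ω => M ω k j) 2 P := by
    intro j
    have h1 : l2norm (Pi.single j (1 : ℝ) : Fin d → ℝ) ≤ (1 : ℝ≥0) := by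
      refine le_of_sq_le_sq ?_ (by positivity)
      rw [l2norm_sq]; simp
    have h2 := (hM.subgaussian_row k h1).memLp 2
    simpa using h2
  have hint : ∀ i j, Integrable (fun ω => M ω k i * M ω k j) P :=
    fun i j => (hLp i).integrable_mul (hLp j)
  have hcov : ∀ i j, ∫ ω, M ω k i * M ω k j ∂P = Sig i j := by
    intro i j
    have := hM.covariance k i j
    rw [covariance_eq_sub (hLp i) (hLp j), hM.centered, zero_mul, sub_zero] at this
    exact this
  have hexp : ∀ ω, (M ω k ⬝ᵥ u) * (M ω k ⬝ᵥ v)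
      = ∑ i, ∑ j, (u i * v j) * (M ω k i * M ω k j) := by
    intro ω
    simp only [dotProduct]
    rw [Finset.sum_mul_sum]
    exact Finset.sum_congr rfl fun i _ => Finset.sum_congr rfl fun j _ => by ring
  simp_rw [hexp]
  rw [integral_finsetSum _ fun i _ => integrable_finsetSum _ fun j _ => (hint i j).const_mul _,
    dotProduct_mulVec_eq_sum]
  refine Finset.sum_congr rfl fun i _ => ?_
  rw [integral_finsetSum _ fun j _ => (hint i j).const_mul _]
  refine Finset.sum_congr rfl fun j _ => ?_
  rw [integral_const_mul, hcov]; ring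

lemma isSymm (hM : IsSubGaussianDesign P M L Sig) (hn : 0 < n) : Sig.IsSymm := by
  ext i j
  rw [transpose_apply, ← hM.covariance ⟨0, hn⟩ i j, ← hM.covariance ⟨0, hn⟩ j i, covariance_comm]

/-- No norm bound on `Sig` is assumed; the sub-Gaussian parameter implies one through second
moments. It is needed to bound `YHat` from above. -/
lemma abs_quadForm_le [IsProbabilityMeasure P] (hM : IsSubGaussianDesign P M L Sig) (hn : 0 < n)
    (hL : 0 < L) {u v : Fin d → ℝ} {a b : ℝ≥0} (ha : 0 < a) (hb : 0 < b) (hu : l2norm u ≤ a)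
    (hv : l2norm v ≤ b) : |u ⬝ᵥ Sig *ᵥ v| ≤ 2 * (L ^ 2 * (a * b)) := by
  rw [← hM.integral_row_mul_row ⟨0, hn⟩ u v]
  have := abs_integral_mul_le (P := P) (mul_pos hL ha) (mul_pos hL hb)
    (hM.measurable_row ⟨0, hn⟩ u) (hM.measurable_row ⟨0, hn⟩ v)
    (hM.subgaussian_row ⟨0, hn⟩ hu) (hM.subgaussian_row ⟨0, hn⟩ hv)
  push_cast at this
  linarith

lemma gram_apply {n d : ℕ} (M : Matrix (Fin n) (Fin d) ℝ) (u v : Fin d → ℝ) :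
    u ⬝ᵥ ((1 / (n : ℝ)) • (Mᵀ * M)) *ᵥ v = 1 / (n : ℝ) * ∑ k, (M k ⬝ᵥ u) * (M k ⬝ᵥ v) := by
  rw [Matrix.smul_mulVec, dotProduct_smul, smul_eq_mul, ← Matrix.mulVec_mulVec,
    Matrix.dotProduct_mulVec, Matrix.vecMul_transpose]
  rfl

/-- Concentration of the bilinear forms of the sample covariance matrix. -/
lemma measure_abs_bilin_ge_le [IsProbabilityMeasure P] (hM : IsSubGaussianDesign P M L Sig)
    (hn : 0 < n) (hL : 0 < L) {u v : Fin d → ℝ} {a b : ℝ≥0} (ha : 0 < a) (hb : 0 < b)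
    (hu : l2norm u ≤ a) (hv : l2norm v ≤ b) {s : ℝ} (hs0 : 0 ≤ s) (hs1 : s ≤ 1) :
    P.real {ω | 80 * (L ^ 2 * (a * b)) * s
        ≤ |u ⬝ᵥ ((1 / (n : ℝ)) • ((M ω)ᵀ * M ω) - Sig) *ᵥ v|}
      ≤ 2 * Real.exp (-(n * s ^ 2)) := by
  have hind : iIndepFun (fun k ω => (M ω k ⬝ᵥ u) * (M ω k ⬝ᵥ v)) P := by
    refine hM.indep.comp (fun _ r => (r ⬝ᵥ u) * (r ⬝ᵥ v)) fun _ => ?_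
    simp only [dotProduct]
    fun_prop
  have key := measure_abs_average_mul_sub_ge_le hn (mul_pos hL ha) (mul_pos hL hb)
    (fun k => hM.measurable_row k u) (fun k => hM.measurable_row k v)
    (fun k => hM.subgaussian_row k hu) (fun k => hM.subgaussian_row k hv) hind
    (fun k => hM.integral_row_mul_row k u v) hs0 hs1
  have hset : {ω | 80 * ((L : ℝ) ^ 2 * (a * b)) * s
        ≤ |u ⬝ᵥ ((1 / (n : ℝ)) • ((M ω)ᵀ * M ω) - Sig) *ᵥ v|}
      = {ω | 80 * (((L * a : ℝ≥0) : ℝ) * ((L * b : ℝ≥0) : ℝ)) * s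
        ≤ |1 / (n : ℝ) * ∑ k, (M ω k ⬝ᵥ u) * (M ω k ⬝ᵥ v) - u ⬝ᵥ Sig *ᵥ v|} := by
    ext ω
    simp only [Set.mem_ofPred_eq]
    rw [Matrix.sub_mulVec, dotProduct_sub, gram_apply]
    push_cast
    rw [show 80 * ((L : ℝ) ^ 2 * (a * b)) * s = 80 * ((L : ℝ) * a * (L * b)) * s by ring]
  rw [hset]
  exact key

/-- Concentration of the correlations between the columns of the design and the response. -/
lemma measure_abs_response_ge_le [IsProbabilityMeasure P] (hM : IsSubGaussianDesign P M L Sig)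
    {ε : Ω → Fin n → ℝ} {ϱ : ℝ≥0} (hε : IsSubGaussianNoise P ε ϱ)
    (hind : IndepFun (fun ω => (fun i j => M ω i j : Fin n → Fin d → ℝ)) ε P)
    (hn : 0 < n) (hL : 0 < L) {u z : Fin d → ℝ} {a c : ℝ≥0} (ha : 0 < a) (hc : 0 < c)
    (hu : l2norm u ≤ a) (hz : L ^ 2 * l2norm z ^ 2 + ϱ ^ 2 ≤ (c : ℝ) ^ 2)
    {s : ℝ} (hs0 : 0 ≤ s) (hs1 : s ≤ 1) :
    P.real {ω | 80 * (L * a * c) * s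
        ≤ |1 / (n : ℝ) * ∑ k, (M ω k ⬝ᵥ u) * (M ω k ⬝ᵥ z + ε ω k) - u ⬝ᵥ Sig *ᵥ z|}
      ≤ 2 * Real.exp (-(n * s ^ 2)) := by
  have hindk : ∀ k, IndepFun (fun ω => M ω k) (fun ω => ε ω k) P := fun k =>
    hind.comp (measurable_pi_apply (X := fun _ : Fin n => Fin d → ℝ) k)
      (measurable_pi_apply (X := fun _ : Fin n => ℝ) k)
  have hlin : ∀ w : Fin d → ℝ, Measurable fun r : Fin d → ℝ => r ⬝ᵥ w := by
    intro w
    simp only [dotProduct]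
    fun_prop
  have hrow : ∀ k, Measurable fun ω => M ω k := fun k => measurable_pi_lambda _ (hM.measurable k)
  -- A row of the design and its noise entry are independent, so their variance parameters add.
  have hY : ∀ k, HasSubgaussianMGF (fun ω => M ω k ⬝ᵥ z + ε ω k) (c ^ 2) P := by
    intro k
    have h1 := hM.subgaussian_row k (u := z) (a := ⟨l2norm z, l2norm_nonneg z⟩) le_rfl
    have h2 := h1.add_of_indepFun (hε.subGaussian k) ((hindk k).comp (hlin z) measurable_id)
    refine HasSubgaussianMGF.mono h2 ?_
    rw [← NNReal.coe_le_coe]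
    push_cast
    show ((L : ℝ) * l2norm z) ^ 2 + (ϱ : ℝ) ^ 2 ≤ (c : ℝ) ^ 2
    rw [mul_pow]; exact hz
  have hmean : ∀ k, ∫ ω, (M ω k ⬝ᵥ u) * (M ω k ⬝ᵥ z + ε ω k) ∂P = u ⬝ᵥ Sig *ᵥ z := by
    intro k
    have hX2 : MemLp (fun ω => M ω k ⬝ᵥ u) 2 P := (hM.subgaussian_row k hu).memLp 2
    have hZ2 : MemLp (fun ω => M ω k ⬝ᵥ z) 2 P :=
      (hM.subgaussian_row k (u := z) (a := ⟨l2norm z, l2norm_nonneg z⟩) le_rfl).memLp 2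
    have hE2 : MemLp (fun ω => ε ω k) 2 P := (hε.subGaussian k).memLp 2
    have hXZ : Integrable (fun ω => (M ω k ⬝ᵥ u) * (M ω k ⬝ᵥ z)) P := hX2.integrable_mul hZ2
    have hXE : Integrable (fun ω => (M ω k ⬝ᵥ u) * ε ω k) P := hX2.integrable_mul hE2
    simp_rw [mul_add]
    rw [integral_add hXZ hXE, hM.integral_row_mul_row]
    have h3 : ∫ ω, (M ω k ⬝ᵥ u) * ε ω k ∂P = (∫ ω, M ω k ⬝ᵥ u ∂P) * ∫ ω, ε ω k ∂P :=
      ((hindk k).comp (hlin u) measurable_id).integral_mul_eq_mul_integral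
        (hM.measurable_row k u).aestronglyMeasurable (hε.measurable k).aestronglyMeasurable
    rw [h3, hε.centered, mul_zero, add_zero]
  have hjoint : iIndepFun (fun k ω => ((fun j => M ω k j : Fin d → ℝ), ε ω k)) P :=
    iIndepFun_prodMk_of_indepFun hrow hε.measurable hM.indep hε.indep hind
  have hprod : iIndepFun (fun k ω => (M ω k ⬝ᵥ u) * (M ω k ⬝ᵥ z + ε ω k)) P := by
    refine hjoint.comp (fun _ q => (q.1 ⬝ᵥ u) * (q.1 ⬝ᵥ z + q.2)) fun _ => ?_
    exact ((hlin u).comp measurable_fst).mul (((hlin z).comp measurable_fst).add measurable_snd)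
  have key := measure_abs_average_mul_sub_ge_le hn (mul_pos hL ha) hc
    (fun k => hM.measurable_row k u) (fun k => (hM.measurable_row k z).add (hε.measurable k))
    (fun k => hM.subgaussian_row k hu) hY hprod hmean hs0 hs1
  push_cast at key
  exact key

/-- Concentration of the sample covariance matrix in operator norm on the vectors supported on a
set. -/
lemma measure_exists_abs_quadForm_gt_le [IsProbabilityMeasure P]
    (hM : IsSubGaussianDesign P M L Sig) (hn : 0 < n) (hL : 0 < L) (S : Finset (Fin d))
    {s : ℝ} (hs0 : 0 ≤ s) (hs1 : s ≤ 1) :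
    P.real {ω | ∃ u : Fin d → ℝ, (∀ i ∉ S, u i = 0) ∧
        320 * L ^ 2 * s * (u ⬝ᵥ u) < |u ⬝ᵥ ((1 / (n : ℝ)) • ((M ω)ᵀ * M ω) - Sig) *ᵥ u|}
      ≤ 25 ^ S.card * (2 * Real.exp (-(n * s ^ 2))) := by
  obtain ⟨N, hNcard, hN1, hnet⟩ := exists_half_net (EuclideanSpace ℝ S)
  rw [finrank_euclideanSpace, Fintype.card_coe] at hNcard
  -- Extension by zero lets the net live in dimension `|S|` instead of `d`, which is why the union
  -- bound costs only `25 ^ |S|`.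
  set ext : EuclideanSpace ℝ S → Fin d → ℝ :=
    fun v i => if h : i ∈ S then v ⟨i, h⟩ else 0 with hext
  have hsum : ∀ f : Fin d → ℝ, (∀ i ∉ S, f i = 0) → ∑ i, f i = ∑ i : S, f i := by
    intro f hf
    rw [Finset.sum_coe_sort S f]
    exact (Finset.sum_subset (Finset.subset_univ S) fun i _ hi => hf i hi).symm
  have hextc : ∀ v (i : S), ext v i = v i := fun v i => by simp [hext]
  have hext0 : ∀ v, ∀ i ∉ S, ext v i = 0 := fun v i hi => by simp [hext, hi]
  have hnorm : ∀ v, l2norm (ext v) = ‖v‖ := by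
    intro v
    refine (sq_eq_sq₀ (l2norm_nonneg _) (norm_nonneg _)).mp ?_
    rw [l2norm_sq, EuclideanSpace.norm_sq_eq, dotProduct,
      hsum (fun i => ext v i * ext v i) fun i hi => by rw [hext0 v i hi, zero_mul]]
    exact Finset.sum_congr rfl fun i _ => by rw [hextc, Real.norm_eq_abs, sq_abs, sq]
  set D : Ω → Matrix (Fin d) (Fin d) ℝ := fun ω => (1 / (n : ℝ)) • ((M ω)ᵀ * M ω) - Sig with hD
  have hform : ∀ ω (u v : EuclideanSpace ℝ S),
      inner ℝ u (Matrix.toEuclideanCLM (𝕜 := ℝ) (block S S (D ω)) v)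
        = ext u ⬝ᵥ D ω *ᵥ ext v := by
    intro ω u v
    rw [dotProduct_mulVec_eq_sum, hsum _ fun i hi => by
      simp only [hext0 u i hi, zero_mul, Finset.sum_const_zero]]
    rw [PiLp.inner_apply]
    refine Finset.sum_congr rfl fun i _ => ?_
    rw [hsum _ fun j hj => by rw [hext0 v j hj, mul_zero]]
    simp only [hextc, block]
    rw [Matrix.ofLp_toEuclideanCLM]
    simp only [RCLike.inner_apply, conj_trivial, mulVec, dotProduct, submatrix_apply,
      Finset.sum_mul]
    exact Finset.sum_congr rfl fun j _ => by ring
  have hsub : {ω | ∃ u : Fin d → ℝ, (∀ i ∉ S, u i = 0) ∧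
        320 * L ^ 2 * s * (u ⬝ᵥ u) < |u ⬝ᵥ D ω *ᵥ u|}
      ⊆ ⋃ q ∈ N ×ˢ N, {ω | 80 * (L ^ 2 * ((1 : ℝ≥0) * (1 : ℝ≥0))) * s
        ≤ |ext q.1 ⬝ᵥ D ω *ᵥ ext q.2|} := by
    rintro ω ⟨u, hu, hlt⟩
    by_contra hcon
    simp only [Set.mem_iUnion, not_exists, Set.mem_ofPred_eq, not_le] at hcon
    have hop := opNorm_le_of_half_net hnet (Matrix.toEuclideanCLM (𝕜 := ℝ) (block S S (D ω)))
      (m := 80 * (L ^ 2 * ((1 : ℝ≥0) * (1 : ℝ≥0))) * s) fun a ha b hb => by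
        rw [hform]
        exact (hcon (a, b) (Finset.mk_mem_product ha hb)).le
    set w : EuclideanSpace ℝ S := WithLp.toLp 2 fun i : S => u i with hw
    have hwu : ext w = u := by
      funext i
      by_cases hi : i ∈ S
      · simp [hext, hw, hi]
      · rw [hext0 w i hi, hu i hi]
    have h1 := hform ω w w
    rw [hwu] at h1
    have h2 : ‖w‖ ^ 2 = u ⬝ᵥ u := by rw [← hnorm, hwu, l2norm_sq]
    have h3 : |u ⬝ᵥ D ω *ᵥ u| ≤ 4 * (80 * (L ^ 2 * ((1 : ℝ≥0) * (1 : ℝ≥0))) * s) * (u ⬝ᵥ u) := by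
      rw [← h1, ← h2]
      calc _ ≤ ‖w‖ * ‖Matrix.toEuclideanCLM (𝕜 := ℝ) (block S S (D ω)) w‖ :=
            abs_real_inner_le_norm _ _
        _ ≤ ‖w‖ * (‖Matrix.toEuclideanCLM (𝕜 := ℝ) (block S S (D ω))‖ * ‖w‖) := by
            gcongr; exact ContinuousLinearMap.le_opNorm _ _
        _ = ‖Matrix.toEuclideanCLM (𝕜 := ℝ) (block S S (D ω))‖ * ‖w‖ ^ 2 := by ring
        _ ≤ _ := by gcongr
    push_cast at h3
    linarith
  calc _ ≤ P.real (⋃ q ∈ N ×ˢ N, {ω | 80 * (L ^ 2 * ((1 : ℝ≥0) * (1 : ℝ≥0))) * s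
        ≤ |ext q.1 ⬝ᵥ D ω *ᵥ ext q.2|}) := measureReal_mono hsub (measure_ne_top _ _)
    _ ≤ ∑ q ∈ N ×ˢ N, P.real {ω | 80 * (L ^ 2 * ((1 : ℝ≥0) * (1 : ℝ≥0))) * s
        ≤ |ext q.1 ⬝ᵥ D ω *ᵥ ext q.2|} := measureReal_biUnion_finset_le _ _
    _ ≤ ∑ _q ∈ N ×ˢ N, 2 * Real.exp (-(n * s ^ 2)) := by
        refine Finset.sum_le_sum fun q hq => ?_
        have hq' := Finset.mem_product.mp hq
        exact hM.measure_abs_bilin_ge_le hn hL one_pos one_pos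
          (by rw [hnorm]; exact hN1 _ hq'.1) (by rw [hnorm]; exact hN1 _ hq'.2) hs0 hs1
    _ = ((N.card * N.card : ℕ) : ℝ) * (2 * Real.exp (-(n * s ^ 2))) := by
        rw [Finset.sum_const, Finset.card_product, nsmul_eq_mul]
    _ ≤ _ := by
        gcongr
        have : N.card * N.card ≤ 5 ^ S.card * 5 ^ S.card := Nat.mul_le_mul hNcard hNcard
        rw [← mul_pow] at this
        exact_mod_cast this

end IsSubGaussianDesign

/-! ### Union bound and choice of constants -/

lemma measureReal_iUnion_le_card_mul {Ω ι : Type*} [MeasurableSpace Ω] [Fintype ι]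
    (P : Measure Ω) [IsFiniteMeasure P] {A : ι → Set Ω} {q : ℝ} (h : ∀ i, P.real (A i) ≤ q) :
    P.real (⋃ i, A i) ≤ Fintype.card ι * q := by
  calc P.real (⋃ i, A i) ≤ ∑ i, P.real (A i) := measureReal_iUnion_fintype_le _
    _ ≤ ∑ _i : ι, q := Finset.sum_le_sum fun i _ => h i
    _ = _ := by rw [Finset.sum_const, Finset.card_univ, nsmul_eq_mul]

/-- Recovery with high probability when the sample size is large enough. -/
theorem measure_not_recovers_le {n d σ : ℕ} {Sig : Matrix (Fin d) (Fin d) ℝ} {z x : Fin d → ℝ}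
    {L ϱ : ℝ≥0} {δ ℓ : ℝ} (hx : IsTernary x) (hσ : (supp x).card = σ) (hL : 0 < L) (hδ : 0 < δ)
    (hY0 : 0 < YHat Sig z x) (hD1 : CondD1 ℓ σ Sig z x)
    (hD2 : CondD2 960 320 160 480 L ϱ δ n σ Sig z x)
    (hD3 : CondD3 960 320 160 480 L ϱ δ ℓ n σ Sig z x)
    (hn : 0 < n) (hd : 2 ≤ d) (hz : 0 < l2norm z) (hnd : 4 * Real.log d ≤ n) (hnσ : 9 * (σ : ℝ) ≤ n)
    (hlam : 2 * (σ * lamN 480 L ϱ n z) ≤ YHat Sig z x)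
    {Ω : Type*} [MeasurableSpace Ω] {P : Measure Ω} [IsProbabilityMeasure P]
    {M : Ω → Matrix (Fin n) (Fin d) ℝ} {ε : Ω → Fin n → ℝ}
    (hM : IsSubGaussianDesign P M L Sig) (hε : IsSubGaussianNoise P ε ϱ)
    (hind : IndepFun (fun ω => (fun i j => M ω i j : Fin n → Fin d → ℝ)) ε P) :
    P.real {ω | ¬ Recovers (M ω) (M ω *ᵥ z + ε ω) σ x}
      ≤ 6 * (1 / (d : ℝ) + Real.exp (-(σ : ℝ))) := by
  have hn' : (0 : ℝ) < n := by exact_mod_cast hn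
  have hd' : (2 : ℝ) ≤ d := by exact_mod_cast hd
  have hσ0 : 0 < σ := hσ ▸ (supp_nonempty_of_YHat_pos hY0).card_pos
  have hσ' : (0 : ℝ) < σ := by exact_mod_cast hσ0
  have hlog : 0 < Real.log d := Real.log_pos (by linarith)
  have hL' : (0 : ℝ) < L := hL
  -- With `n s₁² = 4 log d` each scalar event has probability at most `2 d⁻⁴`, which survives a
  -- union over `d²` entries. With `n s₂² = 9σ` the net factor `25 ^ σ ≤ e^(8σ)` is beaten with
  -- `e^(-σ)` to spare.
  set s₁ : ℝ := 2 * √(Real.log d / n) with hs₁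
  set s₂ : ℝ := 3 * √((σ : ℝ) / n) with hs₂
  have hs₁0 : 0 ≤ s₁ := by positivity
  have hs₂0 : 0 ≤ s₂ := by positivity
  have hs₁sq : n * s₁ ^ 2 = 4 * Real.log d := by
    rw [hs₁, mul_pow, Real.sq_sqrt (by positivity)]; field_simp; norm_num
  have hs₂sq : n * s₂ ^ 2 = 9 * σ := by
    rw [hs₂, mul_pow, Real.sq_sqrt (by positivity)]; field_simp; norm_num
  have hs₁1 : s₁ ≤ 1 := by
    refine le_of_sq_le_sq ?_ zero_le_one
    rw [one_pow]
    by_contra hcon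
    push Not at hcon
    nlinarith
  have hs₂1 : s₂ ≤ 1 := by
    refine le_of_sq_le_sq ?_ zero_le_one
    rw [one_pow]
    by_contra hcon
    push Not at hcon
    nlinarith
  set c : ℝ≥0 := ⟨√((ϱ : ℝ) ^ 2 + L ^ 2 * l2norm z ^ 2), Real.sqrt_nonneg _⟩ with hc
  have hcv : (c : ℝ) = √((ϱ : ℝ) ^ 2 + L ^ 2 * l2norm z ^ 2) := rfl
  have hc0 : 0 < c := by
    rw [← NNReal.coe_pos, hcv]; positivity
  have hcsq : (L : ℝ) ^ 2 * l2norm z ^ 2 + (ϱ : ℝ) ^ 2 ≤ (c : ℝ) ^ 2 := by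
    rw [hcv, Real.sq_sqrt (by positivity)]; linarith
  set r : ℝ≥0 := ⟨√(σ : ℝ), Real.sqrt_nonneg _⟩ with hr
  have hrv : (r : ℝ) = √(σ : ℝ) := rfl
  have hr0 : 0 < r := by rw [← NNReal.coe_pos, hrv]; positivity
  have hxr : l2norm x ≤ r := by
    refine le_of_sq_le_sq ?_ r.2
    rw [l2norm_sq, sum_sq_eq_card hx hσ, hrv, Real.sq_sqrt hσ'.le]
  have hsingle : ∀ i : Fin d, l2norm (Pi.single i (1 : ℝ) : Fin d → ℝ) ≤ (1 : ℝ≥0) := by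
    intro i
    refine le_of_sq_le_sq ?_ (by positivity)
    rw [l2norm_sq]; simp
  set D : Ω → Matrix (Fin d) (Fin d) ℝ := fun ω => (1 / (n : ℝ)) • ((M ω)ᵀ * M ω) - Sig with hD
  set q : ℝ := 2 * Real.exp (-(n * s₁ ^ 2)) with hq
  set A₁ : Fin d → Set Ω := fun i => {ω | 80 * (L * (1 : ℝ≥0) * c) * s₁
    ≤ |1 / (n : ℝ) * ∑ k, (M ω k ⬝ᵥ Pi.single i (1 : ℝ)) * (M ω k ⬝ᵥ z + ε ω k)
      - Pi.single i (1 : ℝ) ⬝ᵥ Sig *ᵥ z|} with hA₁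
  set A₂ : Fin d × Fin d → Set Ω := fun ij => {ω | 80 * (L ^ 2 * ((1 : ℝ≥0) * (1 : ℝ≥0))) * s₁
    ≤ |Pi.single ij.1 (1 : ℝ) ⬝ᵥ D ω *ᵥ Pi.single ij.2 (1 : ℝ)|} with hA₂
  set A₃ : Fin d → Set Ω := fun i => {ω | 80 * (L ^ 2 * ((1 : ℝ≥0) * r)) * s₁
    ≤ |Pi.single i (1 : ℝ) ⬝ᵥ D ω *ᵥ x|} with hA₃
  set A₄ : Set Ω := {ω | ∃ u : Fin d → ℝ, (∀ i ∉ supp x, u i = 0) ∧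
    320 * L ^ 2 * s₂ * (u ⬝ᵥ u) < |u ⬝ᵥ D ω *ᵥ u|} with hA₄
  have h₁ : P.real (⋃ i, A₁ i) ≤ d * q := by
    have := measureReal_iUnion_le_card_mul P (A := A₁) (q := q) fun i =>
      hM.measure_abs_response_ge_le hε hind hn hL one_pos hc0 (hsingle i) hcsq hs₁0 hs₁1
    rwa [Fintype.card_fin] at this
  have h₂ : P.real (⋃ ij, A₂ ij) ≤ d * d * q := by
    have := measureReal_iUnion_le_card_mul P (A := A₂) (q := q) fun ij =>
      hM.measure_abs_bilin_ge_le hn hL one_pos one_pos (hsingle ij.1) (hsingle ij.2) hs₁0 hs₁1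
    rw [Fintype.card_prod, Fintype.card_fin] at this
    exact_mod_cast this
  have h₃ : P.real (⋃ i, A₃ i) ≤ d * q := by
    have := measureReal_iUnion_le_card_mul P (A := A₃) (q := q) fun i =>
      hM.measure_abs_bilin_ge_le hn hL one_pos hr0 (hsingle i) hxr hs₁0 hs₁1
    rwa [Fintype.card_fin] at this
  have h₄ : P.real A₄ ≤ 25 ^ σ * (2 * Real.exp (-(n * s₂ ^ 2))) := by
    have := hM.measure_exists_abs_quadForm_gt_le hn hL (supp x) hs₂0 hs₂1
    rwa [hσ] at this
  have hsub : {ω | ¬ Recovers (M ω) (M ω *ᵥ z + ε ω) σ x}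
      ⊆ (((⋃ i, A₁ i) ∪ ⋃ ij, A₂ ij) ∪ ⋃ i, A₃ i) ∪ A₄ := by
    intro ω hω
    by_contra hcon
    simp only [Set.mem_union, Set.mem_iUnion, not_or, not_exists, hA₁, hA₂, hA₃, hA₄,
      Set.mem_ofPred_eq, not_le, not_and, not_lt, NNReal.coe_one, mul_one, one_mul, Prod.forall,
      Matrix.mulVec_single_one, single_one_dotProduct, dotProduct_single_one, Matrix.col_apply]
      at hcon
    obtain ⟨⟨⟨hc1, hc2⟩, hc3⟩, hc4⟩ := hcon
    -- The constants are `480 = 3·80·2`, `320 = 2·80·2`, `160 = 80·2` and `960 = 320·3`: the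
    -- deviation constant times the factor in `s₁` or `s₂`, times the share demanded by
    -- `recovers_of_deviation`.
    refine hω (recovers_of_deviation (c₁ := 960) (B := 320) (B₁ := 160) (B₂ := 480) (L := L)
      (ϱ := ϱ) (δ := δ) (ℓ := ℓ) (Sig := Sig) (z := z) hx hσ (by norm_num) rfl rfl hδ hY0
      (hM.isSymm hn) hD1 hD2 hD3 (by unfold lamN; positivity) hlam (by positivity) ?_ ?_ ?_ ?_)
    · intro i
      have h := (hc1 i).le
      have e1 : 480 * (L : ℝ) * √(((ϱ : ℝ) ^ 2 + L ^ 2 * l2norm z ^ 2) * Real.log d / n) / 3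
          = 80 * (L * c) * s₁ := by
        rw [mul_div_assoc ((ϱ : ℝ) ^ 2 + L ^ 2 * l2norm z ^ 2), Real.sqrt_mul (by positivity),
          hcv, hs₁]
        ring
      rw [lamN, e1, abs_sub_comm]
      refine le_trans (le_of_eq ?_) h
      congr 1
      simp only [yHat, Pi.neg_apply, Pi.smul_apply, smul_eq_mul, mulVec, dotProduct,
        transpose_apply, Pi.add_apply]
      ring
    · intro i j
      have h := (hc2 i j).le
      have e1 : 320 * (L : ℝ) ^ 2 * √(Real.log d / n) / 2 = 80 * L ^ 2 * s₁ := by rw [hs₁]; ring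
      rw [e1]
      exact h
    · intro i
      have h := (hc3 i).le
      have e1 : 160 * (L : ℝ) ^ 2 * √(σ * Real.log d / n) = 80 * (L ^ 2 * r) * s₁ := by
        rw [mul_div_assoc, Real.sqrt_mul (by positivity), hrv, hs₁]; ring
      rw [e1]
      exact h
    · intro u hu
      have h := hc4 u fun i hi => hu i (by
        by_contra hne
        exact hi (Finset.mem_filter.mpr ⟨Finset.mem_univ i, hne⟩))
      have e1 : 960 * (L : ℝ) ^ 2 * √((σ : ℝ) / n) = 320 * L ^ 2 * s₂ := by rw [hs₂]; ring
      rw [e1]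
      exact h
  have hqv : q = 2 / (d : ℝ) ^ 4 := by
    rw [hq, hs₁sq, Real.exp_neg, show 4 * Real.log d = ((4 : ℕ) : ℝ) * Real.log d by norm_num,
      Real.exp_nat_mul, Real.exp_log (by linarith)]
    ring
  have hdq : d * q ≤ 2 * (1 / (d : ℝ)) := by
    rw [hqv, mul_div_assoc', mul_one_div, div_le_div_iff₀ (by positivity) (by positivity)]
    nlinarith [pow_le_pow_left₀ (by norm_num) hd' 2, sq_nonneg (d : ℝ)]
  have hddq : d * d * q ≤ 2 * (1 / (d : ℝ)) := by
    rw [hqv, mul_div_assoc', mul_one_div, div_le_div_iff₀ (by positivity) (by positivity)]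
    have : (d : ℝ) ^ 3 * 1 ≤ (d : ℝ) ^ 3 * d := by gcongr; linarith
    nlinarith
  have hexp : 25 ^ σ * (2 * Real.exp (-(n * s₂ ^ 2))) ≤ 2 * Real.exp (-(σ : ℝ)) := by
    have h25 : (25 : ℝ) ≤ Real.exp 8 := by
      have h2 : (2 : ℝ) ≤ Real.exp 1 := by
        have := Real.add_one_le_exp 1; linarith
      calc (25 : ℝ) ≤ 2 ^ 8 := by norm_num
        _ ≤ Real.exp 1 ^ 8 := by gcongr
        _ = Real.exp 8 := by rw [← Real.exp_nat_mul]; norm_num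
    calc (25 : ℝ) ^ σ * (2 * Real.exp (-(n * s₂ ^ 2)))
        ≤ Real.exp 8 ^ σ * (2 * Real.exp (-(n * s₂ ^ 2))) := by gcongr
      _ = 2 * Real.exp (-(σ : ℝ)) := by
        rw [← Real.exp_nat_mul, hs₂sq, mul_left_comm, ← Real.exp_add]; ring_nf
  have hunion : P.real ((((⋃ i, A₁ i) ∪ ⋃ ij, A₂ ij) ∪ ⋃ i, A₃ i) ∪ A₄)
      ≤ d * q + d * d * q + d * q + 25 ^ σ * (2 * Real.exp (-(n * s₂ ^ 2))) :=
    (measureReal_union_le _ _).trans (add_le_add ((measureReal_union_le _ _).trans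
      (add_le_add ((measureReal_union_le _ _).trans (add_le_add h₁ h₂)) h₃)) h₄)
  have hmono : P.real {ω | ¬ Recovers (M ω) (M ω *ᵥ z + ε ω) σ x} ≤ _ :=
    (measureReal_mono hsub (measure_ne_top _ _)).trans hunion
  have hpos := Real.exp_pos (-(σ : ℝ))
  linarith

end SILS

theorem theorem5p2 :
    ∃ c₁ B B₁ B₂ K : ℝ, 0 < c₁ ∧ 0 < B ∧ 0 < B₁ ∧ 0 < B₂ ∧ 0 < K ∧
      ∀ κ : ℝ, 0 < κ → ∃ C : ℝ, 0 < C ∧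
        ∀ (n d σ : ℕ) (Sig : Matrix (Fin d) (Fin d) ℝ) (z x : Fin d → ℝ) (L ϱ : ℝ≥0) (δ ℓ : ℝ),
          SILS.IsTernary x → (SILS.supp x).card = σ → 0 < L → 0 < δ →
          0 < SILS.YHat Sig z x → κ ≤ 1 / (σ : ℝ) * SILS.YHat Sig z x →
          SILS.CondD1 ℓ σ Sig z x →
          SILS.CondD2 c₁ B B₁ B₂ L ϱ δ n σ Sig z x →
          SILS.CondD3 c₁ B B₁ B₂ L ϱ δ ℓ n σ Sig z x →
          C * (L : ℝ) ^ 2 * ((ϱ : ℝ) ^ 2 + (L : ℝ) ^ 2 * SILS.l2norm z ^ 2 + σ) * Real.log d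
            ≤ (n : ℝ) →
          ∀ (Ω : Type*) [MeasurableSpace Ω] (P : Measure Ω) [IsProbabilityMeasure P]
            (M : Ω → Matrix (Fin n) (Fin d) ℝ) (ε : Ω → Fin n → ℝ),
            SILS.IsSubGaussianDesign P M L Sig → SILS.IsSubGaussianNoise P ε ϱ →
            IndepFun (fun ω => (fun i j => M ω i j : Fin n → Fin d → ℝ)) ε P →
            P.real {ω | ¬ SILS.Recovers (M ω) (M ω *ᵥ z + ε ω) σ x}
              ≤ K * (1 / (d : ℝ) + Real.exp (-(σ : ℝ))) := by
  refine ⟨960, 320, 160, 480, 6, by norm_num, by norm_num, by norm_num, by norm_num, by norm_num,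
    fun κ hκ => ⟨10 ^ 6 / κ ^ 2, by positivity, ?_⟩⟩
  intro n d σ Sig z x L ϱ δ ℓ hx hσ hL hδ hY0 hκY hD1 hD2 hD3 hC Ω _ P _ M ε hM hε hind
  have hne := SILS.supp_nonempty_of_YHat_pos hY0
  have hσ0 : 0 < σ := hσ ▸ hne.card_pos
  have hσ' : (1 : ℝ) ≤ σ := by exact_mod_cast hσ0
  have hL' : (0 : ℝ) < L := hL
  -- For `d = 1` the logarithm vanishes and the sample-size hypothesis is empty, but the claimed
  -- bound exceeds one.
  rcases Nat.lt_or_ge d 2 with hd | hd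
  · have hd1 : d = 1 := by
      obtain ⟨i, -⟩ := hne
      have := i.pos
      omega
    have h1 : P.real {ω | ¬ SILS.Recovers (M ω) (M ω *ᵥ z + ε ω) σ x} ≤ 1 := measureReal_le_one
    have h2 : 1 / (d : ℝ) = 1 := by rw [hd1, Nat.cast_one, div_one]
    have := Real.exp_pos (-(σ : ℝ))
    linarith
  have hd' : (2 : ℝ) ≤ d := by exact_mod_cast hd
  have hlog : 1 / 2 ≤ Real.log d := by
    have h1 := Real.log_two_gt_d9
    have h2 := Real.log_le_log (by norm_num) hd'
    linarith
  have hz : 0 < SILS.l2norm z := by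
    refine lt_of_le_of_ne (SILS.l2norm_nonneg _) fun h0 => ?_
    rw [SILS.YHat_eq, SILS.l2norm_eq_zero.mp h0.symm, mulVec_zero, dotProduct_zero] at hY0
    exact lt_irrefl _ hY0
  have hn' : (0 : ℝ) < n := lt_of_lt_of_le (by positivity) hC
  have hn : 0 < n := by exact_mod_cast hn'
  have hκσ : κ * σ ≤ SILS.YHat Sig z x := by
    rw [one_div, inv_mul_eq_div, le_div_iff₀ (by linarith)] at hκY
    exact hκY
  have hYle : SILS.YHat Sig z x ≤ 2 * ((L : ℝ) ^ 2 * (√(σ : ℝ) * SILS.l2norm z)) := by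
    rw [SILS.YHat_eq]
    refine (le_abs_self _).trans (hM.abs_quadForm_le hn hL (a := ⟨√(σ : ℝ), Real.sqrt_nonneg _⟩)
      (b := ⟨SILS.l2norm z, SILS.l2norm_nonneg z⟩) ?_ hz ?_ le_rfl)
    · exact NNReal.coe_pos.mp (show (0 : ℝ) < √(σ : ℝ) by positivity)
    · refine le_of_sq_le_sq ?_ (Real.sqrt_nonneg _)
      rw [SILS.l2norm_sq, SILS.sum_sq_eq_card hx hσ]
      show (σ : ℝ) ≤ √(σ : ℝ) ^ 2
      rw [Real.sq_sqrt (by linarith)]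
  -- A signal of size `κσ` forces `L⁴‖z‖²` to be at least of order `κ²σ`. This removes `L` from the
  -- sample-size hypothesis and gives `n ≥ 10⁵ σ log d` below.
  have hsnr : κ ^ 2 * σ ≤ 4 * ((L : ℝ) ^ 4 * SILS.l2norm z ^ 2) := by
    have h1 : (κ * σ) ^ 2 ≤ (2 * ((L : ℝ) ^ 2 * (√(σ : ℝ) * SILS.l2norm z))) ^ 2 :=
      pow_le_pow_left₀ (by positivity) (hκσ.trans hYle) 2
    have h2 : (2 * ((L : ℝ) ^ 2 * (√(σ : ℝ) * SILS.l2norm z))) ^ 2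
        = 4 * ((L : ℝ) ^ 4 * SILS.l2norm z ^ 2) * σ := by
      rw [mul_pow, mul_pow, mul_pow, Real.sq_sqrt (by linarith)]; ring
    rw [h2] at h1
    refine le_of_mul_le_mul_right (a := (σ : ℝ)) ?_ (by linarith)
    linarith
  have hnlow : 10 ^ 6 * (L : ℝ) ^ 2 * ((ϱ : ℝ) ^ 2 + (L : ℝ) ^ 2 * SILS.l2norm z ^ 2)
      * Real.log d ≤ κ ^ 2 * n := by
    have h1 : 10 ^ 6 / κ ^ 2 * (L : ℝ) ^ 2 * ((ϱ : ℝ) ^ 2 + (L : ℝ) ^ 2 * SILS.l2norm z ^ 2)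
        * Real.log d ≤ n := by
      refine le_trans ?_ hC
      exact mul_le_mul_of_nonneg_right (mul_le_mul_of_nonneg_left (by linarith) (by positivity))
        (by linarith)
    calc _ = κ ^ 2 * (10 ^ 6 / κ ^ 2 * (L : ℝ) ^ 2
          * ((ϱ : ℝ) ^ 2 + (L : ℝ) ^ 2 * SILS.l2norm z ^ 2) * Real.log d) := by field_simp
      _ ≤ κ ^ 2 * n := by gcongr
  have hnσd : 10 ^ 5 * (σ * Real.log d) ≤ n := by
    have h1 : 10 ^ 6 * ((L : ℝ) ^ 4 * SILS.l2norm z ^ 2) * Real.log d ≤ κ ^ 2 * n := by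
      refine le_trans ?_ hnlow
      have : (0 : ℝ) ≤ 10 ^ 6 * (L : ℝ) ^ 2 * (ϱ : ℝ) ^ 2 * Real.log d := by positivity
      linarith
    have h2 : 10 ^ 6 * (κ ^ 2 * σ) * Real.log d
        ≤ 10 ^ 6 * (4 * ((L : ℝ) ^ 4 * SILS.l2norm z ^ 2)) * Real.log d := by gcongr
    have h3 : κ ^ 2 * (10 ^ 6 * (σ * Real.log d)) ≤ κ ^ 2 * (4 * n) := by linarith
    have h4 := le_of_mul_le_mul_left h3 (by positivity)
    have h5 : 0 ≤ (σ : ℝ) * Real.log d := by positivity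
    linarith
  have hσlog : Real.log d ≤ σ * Real.log d := le_mul_of_one_le_left (by linarith) hσ'
  have hσhalf : (σ : ℝ) * (1 / 2) ≤ σ * Real.log d := by gcongr
  -- Numerically this is `4 · 480² ≤ 10⁶`; it makes `σ λ_n` at most half of `YHat`.
  have hlamle : SILS.lamN 480 L ϱ n z ≤ κ / 2 := by
    have h1 : 0 ≤ SILS.lamN 480 L ϱ n z := by unfold SILS.lamN; positivity
    refine le_of_sq_le_sq ?_ (by positivity)
    rw [SILS.lamN, mul_pow, Real.sq_sqrt (by positivity), mul_div_assoc', div_le_iff₀ hn']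
    have h2 : 0 ≤ (L : ℝ) ^ 2 * ((ϱ : ℝ) ^ 2 + (L : ℝ) ^ 2 * SILS.l2norm z ^ 2) * Real.log d := by
      positivity
    linarith
  refine SILS.measure_not_recovers_le hx hσ hL hδ hY0 hD1 hD2 hD3 hn hd hz (by linarith)
    (by linarith) ?_ hM hε hind
  have : (σ : ℝ) * SILS.lamN 480 L ϱ n z ≤ σ * (κ / 2) := by gcongr
  linarith
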